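/- A \emph{network} consists of a finite multigraph $G=(N,E)$, a set $T\subseteq N$ of terminals and a demand graph $(T,S)$. It is \emph{Eulerian} if every inner node (node in $N\setminus T$) has even degree. Let $\mathcal K$ be the set of anticliques (inclusion-maximal stable sets) of $(T,S)$. The Eulerian network $(G,T,\mathcal K)$ is a \emph{K-network} if any three distinct pairwise intersecting $A,B,C\in\mathcal K$ satisfy $A\cap B=A\cap C=B\cap C$. A $T$-path is a path in $G$ (traversing no edge twice) with two distinct ends in $T$. A fractional $T$-flow is a function $f\ge 0$ on the $T$-paths such that, for all nodes $x,y$, $\sum_P f(P)I(P,(x,y))\le c(x,y)$, where $c(x,y)$ is the number of $(x,y)$-edges of $G$ and $I(P,(x,y))$ is the number of those traversed by $P$. Let $\omega(u,v)$ be $1$ if $(u,v)\in S$, $\tfrac12$ if $\{u,v\}$ is contained in exactly one member of $\mathcal K$, and $0$ otherwise. The $W$-problem is to maximize $\Theta(f)=\sum_{\{u,v\}}\omega(u,v)f[u,v]$ over all fractional $T$-flows $f$, where $f[u,v]$ is the total weight of the paths with ends $u,v$; its maximum is denoted by $\theta(G,T,\mathcal K)$. A \emph{split} of an inner node $x$ removes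 $x$ and links its neighbours by $d(x)/2$ new edges (not counting loops at $x$, if any) so that the degrees of all remaining nodes are preserved (loops count twice in degrees). \textbf{Corollary.} For every Eulerian K-network $(G,T,\mathcal K)$, the maximum $\theta(G,T,\mathcal K)$ exists and $2\,\theta(G,T,\mathcal K)$ is a nonnegative integer. Moreover, every network $(G',T,\mathcal K)$ obtained from it by a split of an inner node is again an Eulerian K-network, and $$\theta(G',T,\mathcal K)=\theta(G,T,\mathcal K)-\frac k2\quad\text{for some } k\in\mathbb N\cup\{0\}.$$ -/

import Mathlib

open scoped Graph

namespace PathPacking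

noncomputable section

/-! ### Multigraphs

Multigraphs are Mathlib's `Graph α β`; parallel edges and loops are allowed. -/

/-- `c(x, y)`: the number of `(x, y)`-edges of `G`. -/
def edgeCount {α β : Type*} (G : Graph α β) (x y : α) : ℕ :=
  {e | G.IsLink e x y}.ncard

/-- The degree of a node: the number of incident edges, loops counted twice. -/
def degree {α β : Type*} (G : Graph α β) (x : α) : ℕ :=
  (G.incidenceSet x).ncard + (G.loopSet x).ncard

/-- `IsWalk G u es v`: the edge sequence `es` is traversed by a walk of `G` from `u` to `v`. -/
inductive IsWalk {α β : Type*} (G : Graph α β) : α → List β → α → Prop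
  | nil {x : α} (hx : x ∈ V(G)) : IsWalk G x [] x
  | cons {x y z : α} {e : β} {es : List β} (he : G.IsLink e x y) (hes : IsWalk G y es z) :
      IsWalk G x (e :: es) z

/-- A `T`-path: an unclosed path of `G` (no edge is traversed twice) with both ends in `T`.
It may pass through further terminals. -/
structure TPath {α β : Type*} (G : Graph α β) (T : Set α) where
  source : T
  target : T
  edges : List β
  unclosed : source ≠ target
  isWalk : IsWalk G source.1 edges target.1
  nodup : edges.Nodup

/-- `I(P, (x, y))`: the number of `(x, y)`-edges of `G` traversed by `P`. -/
def TPath.traversals {α β : Type*} {G : Graph α β} {T : Set α} (P : TPath G T) (x y : α) : ℕ :=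
  {e | e ∈ P.edges ∧ G.IsLink e x y}.ncard

/-- A fractional `T`-flow: a non-negative weight function on the `T`-paths which satisfies the
edge capacity constraints. (A finite network has only finitely many `T`-paths, so finite support
is no restriction.) -/
structure IsFractionalFlow {α β : Type*} (G : Graph α β) (T : Set α) (f : TPath G T →₀ ℝ) :
    Prop where
  nonneg : ∀ P, 0 ≤ f P
  capacity : ∀ x ∈ V(G), ∀ y ∈ V(G),
    (f.sum fun P w => w * (P.traversals x y : ℝ)) ≤ (edgeCount G x y : ℝ)

/-! ### Demand graphs and the weak problem -/

/-- The anticliques (inclusion-maximal stable sets) of a demand graph. -/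
def anticliques {ι : Type*} (S : SimpleGraph ι) : Set (Set ι) :=
  {A | Maximal (fun B : Set ι => S.IsIndepSet B) A}

/-- Any three distinct pairwise intersecting members `A`, `B`, `C` satisfy
`A ∩ B = A ∩ C = B ∩ C`. -/
def IsKClutter {ι : Type*} (K : Set (Set ι)) : Prop :=
  ∀ A ∈ K, ∀ B ∈ K, ∀ C ∈ K, A ≠ B → A ≠ C → B ≠ C →
    (A ∩ B).Nonempty → (A ∩ C).Nonempty → (B ∩ C).Nonempty →
      A ∩ B = A ∩ C ∧ A ∩ C = B ∩ C

open Classical in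
/-- The reward function of the weak problem: `1` on demand pairs, `1 / 2` on pairs covered by
exactly one anticlique, `0` on the other pairs. -/
def weakReward {ι : Type*} (S : SimpleGraph ι) (s t : ι) : ℝ :=
  if S.Adj s t then 1
  else if ∃! A : Set ι, A ∈ anticliques S ∧ s ∈ A ∧ t ∈ A then 1 / 2
  else 0

/-- An Eulerian K-network `(G, T, 𝒦)`: a finite multigraph `G`, a set `T` of terminals, all inner
nodes (non-terminals) of even degree, and a demand graph `S` on `T` whose anticlique clutter `𝒦`
is a K-clutter. -/
structure IsKNetwork {α β : Type*} (G : Graph α β) (T : Set α) (S : SimpleGraph T) : Prop where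
  finite_vertexSet : V(G).Finite
  finite_edgeSet : E(G).Finite
  terminals_subset : T ⊆ V(G)
  even_degree : ∀ x ∈ V(G) \ T, Even (degree G x)
  isKClutter : IsKClutter (anticliques S)

/-- `Θ(f)`: the total weak reward of `f`. Every path is counted once in `f[u, v]` for the unordered
pair `{u, v}` of its ends, so this is the sum of `ω(u, v) f[u, v]` over unordered pairs. -/
def weakValue {α β : Type*} {G : Graph α β} {T : Set α} (S : SimpleGraph T)
    (f : TPath G T →₀ ℝ) : ℝ :=
  f.sum fun P w => weakReward S P.source P.target * w

/-- The values of the fractional `T`-flows in the `W`-problem. -/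
def weakValues {α β : Type*} (G : Graph α β) (T : Set α) (S : SimpleGraph T) : Set ℝ :=
  {r | ∃ f : TPath G T →₀ ℝ, IsFractionalFlow G T f ∧ weakValue S f = r}

/-- `θ(G, T, 𝒦)`: the optimum of the `W`-problem. -/
def theta {α β : Type*} (G : Graph α β) (T : Set α) (S : SimpleGraph T) : ℝ :=
  sSup (weakValues G T S)

/-! ### Splits -/

open Classical in
/-- `G'` arises from the finite multigraph `G` by a split of the node `x`: `x` is removed with its
edges, and neighbours of `x` are linked by new edges so that all remaining nodes keep their degree.
The multiset `F` lists the ends of the new edges. Their number is `d(x) / 2`, where loops at `x`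
(if any) are discarded. A new edge may be parallel to other edges, or a loop, if two parallel edges
at `x` are joined to each other. -/
def IsSplit {α β γ : Type*} (G : Graph α β) (x : α) (G' : Graph α γ) : Prop :=
  V(G') = V(G) \ {x} ∧ E(G').Finite ∧
    ∃ F : Multiset (Sym2 α),
      (∀ p ∈ F, ∀ y ∈ p, y ≠ x ∧ G.Adj x y) ∧
      2 * F.card + 2 * edgeCount G x x = degree G x ∧
      (∀ y z : α, y ≠ x → z ≠ x →
        edgeCount G' y z = edgeCount G y z + F.count s(y, z)) ∧
      ∀ y ∈ V(G'), degree G' y = degree G y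

end

end PathPacking

/-! Four times the reward is a distance between terminals in a bipartite graph, the frame: a center
joined to all anticliques, each anticlique joined to its terminals, and terminals with two common
anticliques identified. The K-clutter condition gives the triangle inequality (`classDist_triangle`,
`frameDist_triangle`).

A map of the nodes to the frame that keeps every terminal in its class bounds `8 * Θ(f)` by
`frameCost`, twice the total edge length (`weakValue_le_frameCost`). This bound is attained: linear
programming duality yields optimal edge lengths, the truncated distances of a node from the
terminals place it in a triangle spanned by the center, an anticlique and a terminal, and rounding
all nodes to triangle vertices at one random threshold does not increase the expected length of an
edge (`IsNear.exists_integrable_bound`). Hence `8 * θ` is the least frame cost.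

Since the frame is bipartite, the total edge length has the parity of the sum of the degrees of the
nodes placed on anticliques. These are inner nodes, of even degree, so 4 divides the frame cost and
`2 * θ` is an integer. Under a split, the optimal map is restricted to the remaining nodes; by the
triangle inequality its cost does not grow (`frameCost_split_le`), so `θ` drops by a multiple of one
half. The maximum exists by compactness. -/

namespace PathPacking

noncomputable section

/-! ### The pseudometric of the rewards -/

section ClassDistance

variable {ι : Type*} {S : SimpleGraph ι}

lemma exists_anticlique_of_isIndepSet [Finite ι] {B : Set ι} (hB : S.IsIndepSet B) :
    ∃ A ∈ anticliques S, B ⊆ A := by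
  obtain ⟨A, hBA, hA⟩ := (Set.toFinite {B : Set ι | S.IsIndepSet B}).exists_le_maximal hB
  exact ⟨A, hA, hBA⟩

lemma exists_anticlique_of_not_adj [Finite ι] {s t : ι} (h : ¬ S.Adj s t) :
    ∃ A ∈ anticliques S, s ∈ A ∧ t ∈ A := by
  have hB : S.IsIndepSet {s, t} := by
    rintro u (rfl | rfl) v (rfl | rfl) huv
    · exact absurd rfl huv
    · exact h
    · exact fun h' => h h'.symm
    · exact absurd rfl huv
  obtain ⟨A, hA, hBA⟩ := exists_anticlique_of_isIndepSet hB
  exact ⟨A, hA, hBA (by simp), hBA (by simp)⟩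

lemma not_adj_of_mem_anticlique {A : Set ι} (hA : A ∈ anticliques S) {s t : ι} (hs : s ∈ A)
    (ht : t ∈ A) : ¬ S.Adj s t := by
  intro h
  exact hA.1 hs ht h.ne h

open Classical in
/-- Four times the weak reward, set to `0` on the diagonal. -/
def classDist (S : SimpleGraph ι) (s t : ι) : ℕ :=
  if s = t then 0
  else if S.Adj s t then 4
  else if ∃! A : Set ι, A ∈ anticliques S ∧ s ∈ A ∧ t ∈ A then 2
  else 0

lemma classDist_self (s : ι) : classDist S s s = 0 := by simp [classDist]

lemma classDist_cast {s t : ι} (h : s ≠ t) : (classDist S s t : ℝ) = 4 * weakReward S s t := by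
  unfold classDist weakReward
  rw [if_neg h]
  split_ifs <;> norm_num

open Classical in
lemma classDist_comm (s t : ι) : classDist S s t = classDist S t s := by
  have h : (∃! A : Set ι, A ∈ anticliques S ∧ s ∈ A ∧ t ∈ A) ↔
      ∃! A : Set ι, A ∈ anticliques S ∧ t ∈ A ∧ s ∈ A := by
    simp only [and_comm (a := s ∈ _)]
  unfold classDist
  exact if_congr eq_comm rfl (if_congr (S.adj_comm s t) rfl (if_congr h rfl rfl))

lemma classDist_cases (s t : ι) :
    classDist S s t = 0 ∨ classDist S s t = 2 ∨ classDist S s t = 4 := by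
  unfold classDist
  split_ifs <;> simp

lemma classDist_le_four (s t : ι) : classDist S s t ≤ 4 := by
  rcases classDist_cases (S := S) s t with h | h | h <;> omega

lemma classDist_le_two {A : Set ι} (hA : A ∈ anticliques S) {s t : ι} (hs : s ∈ A)
    (ht : t ∈ A) : classDist S s t ≤ 2 := by
  unfold classDist
  rw [if_neg (not_adj_of_mem_anticlique hA hs ht)]
  split_ifs <;> simp

lemma exists_anticlique_of_classDist_lt [Finite ι] {s t : ι} (h : classDist S s t < 4) :
    ∃ A ∈ anticliques S, s ∈ A ∧ t ∈ A := by
  apply exists_anticlique_of_not_adj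
  intro hadj
  simp [classDist, hadj, hadj.ne] at h

lemma eq_of_classDist_ne_zero {s t : ι} (h : classDist S s t ≠ 0) {A B : Set ι}
    (hA : A ∈ anticliques S) (hB : B ∈ anticliques S) (hsA : s ∈ A) (htA : t ∈ A)
    (hsB : s ∈ B) (htB : t ∈ B) : A = B := by
  unfold classDist at h
  rw [if_neg (not_adj_of_mem_anticlique hA hsA htA)] at h
  split_ifs at h with h1 h2
  · exact absurd rfl h
  · exact h2.unique ⟨hA, hsA, htA⟩ ⟨hB, hsB, htB⟩
  · exact absurd rfl h

lemma exists_two_anticliques_of_classDist_eq_zero [Finite ι] {s t : ι} (hst : s ≠ t)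
    (h : classDist S s t = 0) :
    ∃ A ∈ anticliques S, ∃ B ∈ anticliques S, A ≠ B ∧ s ∈ A ∧ t ∈ A ∧ s ∈ B ∧ t ∈ B := by
  obtain ⟨A, hA, hsA, htA⟩ := exists_anticlique_of_classDist_lt (h.trans_lt (by norm_num))
  by_contra! hcon
  have hu : ∃! A : Set ι, A ∈ anticliques S ∧ s ∈ A ∧ t ∈ A := by
    refine ⟨A, ⟨hA, hsA, htA⟩, fun B hB => ?_⟩
    by_contra hne
    exact hcon A hA B hB.1 (Ne.symm hne) hsA htA hB.2.1 hB.2.2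
  simp [classDist, hst, not_adj_of_mem_anticlique hA hsA htA, hu] at h

/-- Distinct terminals at distance 0 lie in two common anticliques `A` and `B`. If `C` differs from
both, all three meet pairwise in `s`, so `A ∩ B = A ∩ C` by the clutter condition, and `t` is in the
former. -/
lemma mem_of_classDist_eq_zero [Finite ι] (hK : IsKClutter (anticliques S)) {s t : ι}
    (h : classDist S s t = 0) {C : Set ι} (hC : C ∈ anticliques S) (hs : s ∈ C) : t ∈ C := by
  by_cases hst : s = t
  · exact hst ▸ hs
  obtain ⟨A, hA, B, hB, hAB, hsA, htA, hsB, htB⟩ :=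
    exists_two_anticliques_of_classDist_eq_zero hst h
  by_cases hAC : A = C
  · exact hAC ▸ htA
  by_cases hBC : B = C
  · exact hBC ▸ htB
  have := (hK A hA B hB C hC hAB hAC hBC ⟨s, hsA, hsB⟩ ⟨s, hsA, hs⟩ ⟨s, hsB, hs⟩).1
  exact (this ▸ (⟨htA, htB⟩ : t ∈ A ∩ B) : t ∈ A ∩ C).2

lemma mem_iff_of_classDist_eq_zero [Finite ι] (hK : IsKClutter (anticliques S)) {s t : ι}
    (h : classDist S s t = 0) {C : Set ι} (hC : C ∈ anticliques S) : s ∈ C ↔ t ∈ C :=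
  ⟨mem_of_classDist_eq_zero hK h hC,
    mem_of_classDist_eq_zero hK ((classDist_comm t s).trans h) hC⟩

/-- Anticliques of a K-clutter contain no triangles of pairwise different classes. -/
lemma classDist_eq_four [Finite ι] (hK : IsKClutter (anticliques S)) {s t u : ι} {A B : Set ι}
    (hA : A ∈ anticliques S) (hB : B ∈ anticliques S) (hAB : A ≠ B) (hsA : s ∈ A) (htA : t ∈ A)
    (htB : t ∈ B) (huB : u ∈ B) (hst : classDist S s t ≠ 0) (htu : classDist S t u ≠ 0) :
    classDist S s u = 4 := by
  -- An anticlique `C` through `s` and `u` would meet `A` and `B`, so the clutter condition puts `t`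
  -- into `C`. Then `s` and `t` share `A` and `C`, against their nonzero distance.
  by_contra hne
  obtain ⟨C, hC, hsC, huC⟩ :=
    exists_anticlique_of_classDist_lt (lt_of_le_of_ne (classDist_le_four s u) hne)
  have hAC : A ≠ C := by
    rintro rfl
    exact hAB (eq_of_classDist_ne_zero htu hA hB htA huC htB huB)
  have hBC : B ≠ C := by
    rintro rfl
    exact hAB (eq_of_classDist_ne_zero hst hA hB hsA htA hsC htB)
  have := (hK A hA B hB C hC hAB hAC hBC ⟨t, htA, htB⟩ ⟨s, hsA, hsC⟩ ⟨u, huB, huC⟩).1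
  have htC : t ∈ C := (this ▸ (⟨htA, htB⟩ : t ∈ A ∩ B) : t ∈ A ∩ C).2
  exact hAC (eq_of_classDist_ne_zero hst hA hC hsA htA hsC htC)

lemma classDist_le_of_classDist_eq_zero [Finite ι] (hK : IsKClutter (anticliques S)) {s t : ι}
    (h : classDist S s t = 0) (u : ι) : classDist S s u ≤ classDist S t u := by
  rcases classDist_cases (S := S) t u with h0 | h2 | h4
  · by_cases htu : t = u
    · subst htu; omega
    obtain ⟨A, hA, B, hB, hAB, htA, huA, htB, huB⟩ :=
      exists_two_anticliques_of_classDist_eq_zero htu h0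
    have hsA := (mem_iff_of_classDist_eq_zero hK h hA).2 htA
    have hsB := (mem_iff_of_classDist_eq_zero hK h hB).2 htB
    by_contra hcon
    exact hAB (eq_of_classDist_ne_zero (s := s) (t := u) (by omega) hA hB hsA huA hsB huB)
  · obtain ⟨A, hA, htA, huA⟩ := exists_anticlique_of_classDist_lt (h2.trans_lt (by norm_num))
    have hsA := (mem_iff_of_classDist_eq_zero hK h hA).2 htA
    have := classDist_le_two hA hsA huA
    omega
  · have := classDist_le_four (S := S) s u
    omega

/-- Nonzero distances are at least 2 and none exceeds 4, so only a zero summand needs the clutter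
condition. -/
lemma classDist_triangle [Finite ι] (hK : IsKClutter (anticliques S)) (s t u : ι) :
    classDist S s u ≤ classDist S s t + classDist S t u := by
  rcases eq_or_ne (classDist S s t) 0 with h | h
  · have := classDist_le_of_classDist_eq_zero hK h u
    omega
  rcases eq_or_ne (classDist S t u) 0 with h' | h'
  · have := classDist_le_of_classDist_eq_zero hK ((classDist_comm u t).trans h') s
    rw [classDist_comm u s, classDist_comm t s] at this
    omega
  · have h1 := classDist_cases (S := S) s t
    have h2 := classDist_cases (S := S) t u
    have h3 := classDist_le_four (S := S) s u
    omega

end ClassDistance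

/-! ### The bipartite frame and its metric -/

section Frame

variable {ι : Type*} {S : SimpleGraph ι}

/-- The vertices of the frame of a demand graph: a center, the anticliques, the terminals. -/
inductive FrameVertex (S : SimpleGraph ι) : Type _
  | center : FrameVertex S
  | line (A : anticliques S) : FrameVertex S
  | terminal (t : ι) : FrameVertex S

/-- The terminals that lie on an anticlique have distance `1` from it, anticliques have distance
`1` from the center; other distances are those along shortest paths. -/
def frameDist : FrameVertex S → FrameVertex S → ℕ := by
  classical exact fun
  | .center, .center => 0
  | .center, .line _ => 1
  | .center, .terminal _ => 2
  | .line _, .center => 1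
  | .line A, .line B => if A = B then 0 else 2
  | .line A, .terminal t => if t ∈ A.1 then 1 else 3
  | .terminal _, .center => 2
  | .terminal t, .line A => if t ∈ A.1 then 1 else 3
  | .terminal s, .terminal t => classDist S s t

lemma frameDist_self (p : FrameVertex S) : frameDist p p = 0 := by
  cases p <;> simp [frameDist, classDist_self]

lemma frameDist_comm (p q : FrameVertex S) : frameDist p q = frameDist q p := by
  cases p <;> cases q <;> simp [frameDist, eq_comm, classDist_comm]

lemma frameDist_triangle [Finite ι] (hK : IsKClutter (anticliques S)) (p q r : FrameVertex S) :
    frameDist p r ≤ frameDist p q + frameDist q r := by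
  rcases p with _ | A | s <;> rcases q with _ | B | t <;> rcases r with _ | C | u <;>
    simp only [frameDist]
  case line.line.line => split_ifs <;> simp_all
  case line.line.terminal => split_ifs <;> simp_all
  case terminal.line.line => split_ifs <;> simp_all
  case terminal.terminal.terminal => exact classDist_triangle hK s t u
  case terminal.line.terminal =>
    have := classDist_le_four (S := S) s u
    split_ifs with h1 h2
    · have := classDist_le_two B.2 h1 h2
      omega
    all_goals omega
  case line.terminal.terminal =>
    have h0 := classDist_cases (S := S) t u
    have h1 : classDist S t u = 0 → (t ∈ A.1 ↔ u ∈ A.1) :=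
      fun h => mem_iff_of_classDist_eq_zero hK h A.2
    split_ifs <;> rcases h0 with h0 | h0 | h0 <;> simp_all
  case terminal.terminal.line =>
    have h0 := classDist_cases (S := S) s t
    have h1 : classDist S s t = 0 → (s ∈ C.1 ↔ t ∈ C.1) :=
      fun h => mem_iff_of_classDist_eq_zero hK h C.2
    split_ifs <;> rcases h0 with h0 | h0 | h0 <;> simp_all
  all_goals first
    | omega
    | (split_ifs <;> omega)
    | (have := classDist_le_four (S := S) s u; omega)

/-- The vertices on the odd side of the bipartite frame. -/
def FrameVertex.isLine : FrameVertex S → Prop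
  | .line _ => True
  | _ => False

open Classical in
lemma frameDist_mod_two (p q : FrameVertex S) :
    frameDist p q % 2 = ((if p.isLine then 1 else 0) + (if q.isLine then 1 else 0)) % 2 := by
  rcases p with _ | A | s <;> rcases q with _ | B | t <;>
    simp [frameDist, FrameVertex.isLine] <;> first | (split_ifs <;> rfl) | skip
  rcases classDist_cases (S := S) s t with h | h | h <;> rw [h]

end Frame

/-! ### Random thresholds -/

section Gap

open MeasureTheory Set

/-- The indicator function of the thresholds that separate `x` from `z`. -/
def gap (x z r : ℝ) : ℝ := (Set.uIoc x z).indicator 1 r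

lemma gap_eq (x z r : ℝ) :
    gap x z r = |(if r ≤ x then 1 else 0) - (if r ≤ z then 1 else 0)| := by
  unfold gap Set.indicator
  simp only [Set.mem_uIoc, Pi.one_apply]
  by_cases h1 : r ≤ x <;> by_cases h2 : r ≤ z <;> simp [h1, h2, not_lt]

lemma integrableOn_gap (x z : ℝ) : IntegrableOn (gap x z) (Ioc 0 1) := by
  unfold gap
  exact (integrable_const (1 : ℝ)).indicator measurableSet_uIoc

lemma integral_gap {x z : ℝ} (hx : x ∈ Icc (0 : ℝ) 1) (hz : z ∈ Icc (0 : ℝ) 1) :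
    ∫ r in Ioc (0 : ℝ) 1, gap x z r = |x - z| := by
  have h : Ioc (0 : ℝ) 1 ∩ uIoc x z = uIoc x z := by
    apply inter_eq_right.2
    intro r hr
    rw [mem_uIoc] at hr
    rcases hr with hr | hr
    · exact ⟨hx.1.trans_lt hr.1, hr.2.trans hz.2⟩
    · exact ⟨hz.1.trans_lt hr.1, hr.2.trans hx.2⟩
  unfold gap
  rw [setIntegral_indicator measurableSet_uIoc, h]
  simp [uIoc, max_sub_min_eq_abs']

lemma exists_threshold_le {h : ℝ → ℝ} {c : ℝ} (hi : IntegrableOn h (Ioc 0 1))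
    (hc : ∫ r in Ioc (0 : ℝ) 1, h r ≤ c) : ∃ r ∈ Ioc (0 : ℝ) 1, h r ≤ c := by
  obtain ⟨r, hr, hle⟩ := exists_le_setAverage (μ := volume) (s := Ioc (0 : ℝ) 1) (by simp)
    (by simp) hi
  refine ⟨r, hr, hle.trans ?_⟩
  rw [setAverage_eq]
  simpa using hc

end Gap

/-! ### Positions in triangles and their rounding -/

section Position

variable {ι : Type*} {S : SimpleGraph ι}

/-- `IsPosition a c A p q`: the point with affinities `a` to the terminals lies in the triangle
spanned by the center, `A` and `c`; `p` is its affinity to the class of `c` and `q` its highest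
affinity to another class, where negative affinities count as `0`. -/
structure IsPosition (a : ι → ℝ) (c : ι) (A : anticliques S) (p q : ℝ) : Prop where
  mem : c ∈ A.1
  nonneg : 0 ≤ q
  le : q ≤ p
  add_le : p + q ≤ 2
  le_fst : ∀ t, a t ≤ p
  fst_eq : p = 0 ∨ p = a c
  le_snd : ∀ t, classDist S c t ≠ 0 → a t ≤ q
  snd_eq : q = 0 ∨ ∃ t ∈ A.1, classDist S c t ≠ 0 ∧ q = a t

/-- A most attractive terminal serves as `c`. If another class has positive affinity, its best
terminal is at distance less than 4 from `c`, hence 2, and their common anticlique is `A`. Otherwise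
any anticlique through `c` will do. -/
lemma exists_isPosition [Finite ι] [Nonempty ι] {a : ι → ℝ}
    (ha : ∀ s t, a s + a t ≤ 4 - classDist S s t) :
    ∃ c A p q, IsPosition (S := S) a c A p q := by
  obtain ⟨c, hc⟩ := Finite.exists_max a
  have hcc : a c ≤ 2 := by
    have := ha c c
    rw [classDist_self] at this
    norm_num at this
    linarith
  by_cases hpos : ∃ t, classDist S c t ≠ 0 ∧ 0 < a t
  · obtain ⟨t, ⟨htc, ht0⟩, ht⟩ := (Set.toFinite {t | classDist S c t ≠ 0 ∧ 0 < a t}).exists_maximalFor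
      a _ hpos
    have htle : ∀ u, classDist S c u ≠ 0 → a u ≤ a t := by
      intro u hu
      rcases le_total (a u) (a t) with h | h
      · exact h
      · exact ht ⟨hu, ht0.trans_le h⟩ h
    have hct := ha c t
    have hlt : classDist S c t < 4 := by
      have h1 := hc t
      have : (classDist S c t : ℝ) < 4 := by linarith
      exact_mod_cast this
    have h2 : classDist S c t = 2 := by
      rcases classDist_cases (S := S) c t with h | h | h <;> omega
    obtain ⟨A, hA, hcA, htA⟩ := exists_anticlique_of_classDist_lt hlt
    refine ⟨c, ⟨A, hA⟩, a c, a t, hcA, ht0.le, hc t, ?_, hc, Or.inr rfl, htle,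
      Or.inr ⟨t, htA, htc, rfl⟩⟩
    rw [h2] at hct
    norm_num at hct
    exact hct
  · push Not at hpos
    obtain ⟨A, hA, hcA, -⟩ := exists_anticlique_of_not_adj (S.loopless.irrefl c)
    refine ⟨c, ⟨A, hA⟩, max 0 (a c), 0, hcA, le_rfl, le_max_left _ _, ?_,
      fun t => (hc t).trans (le_max_right _ _), max_choice _ _, hpos, Or.inl rfl⟩
    rw [add_zero]
    exact max_le (by norm_num) hcc

/-- The vertex of the triangle spanned by the center, `A` and `c` to which the point with
coordinates `y ≤ x` is rounded at the threshold `r`. -/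
def roundVertex (c : ι) (A : anticliques S) (x y r : ℝ) : FrameVertex S :=
  if r ≤ y then .terminal c else if r ≤ x then .line A else .center

lemma threshold_cases {x y : ℝ} (h : y ≤ x) (r : ℝ) :
    (r ≤ y ∧ r ≤ x) ∨ (¬ r ≤ y ∧ r ≤ x) ∨ (¬ r ≤ y ∧ ¬ r ≤ x) := by
  by_cases h1 : r ≤ y
  · exact Or.inl ⟨h1, h1.trans h⟩
  · by_cases h2 : r ≤ x
    · exact Or.inr (Or.inl ⟨h1, h2⟩)
    · exact Or.inr (Or.inr ⟨h1, h2⟩)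

section Rounding

variable {c c' : ι} {A A' : anticliques S} {x y x' y' r : ℝ}

/-- Each `gap` tells whether the threshold separates two coordinates. This and the next bounds
compare the nine pairs of rounded vertices, one bound for each way in which two triangles can be
situated. -/
lemma frameDist_round_same_triangle (h : y ≤ x) (h' : y' ≤ x') (hc : c ∈ A.1) (hc' : c' ∈ A.1)
    (hcc : classDist S c c' = 0) :
    (frameDist (roundVertex c A x y r) (roundVertex c' A x' y' r) : ℝ) ≤
      gap x x' r + gap y y' r := by
  simp only [gap_eq, roundVertex]
  rcases threshold_cases h r with h1 | h1 | h1 <;> rcases threshold_cases h' r with h2 | h2 | h2 <;>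
    simp [h1, h2, frameDist, hc, hc', hcc] <;> norm_num

/-- The triangles share the side from the center to the class of `c`. Unfolding across it is a
reflection that exchanges the coordinates of one triangle. -/
lemma frameDist_round_same_class (h : y ≤ x) (h' : y' ≤ x') (hA : A ≠ A')
    (hcA' : c ∈ A'.1) (hcA : c' ∈ A.1) (hcc : classDist S c c' = 0) :
    (frameDist (roundVertex c A x y r) (roundVertex c' A' x' y' r) : ℝ) ≤
      gap x y' r + gap y x' r := by
  simp only [gap_eq, roundVertex]
  rcases threshold_cases h r with h1 | h1 | h1 <;> rcases threshold_cases h' r with h2 | h2 | h2 <;>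
    simp [h1, h2, frameDist, hA, hcA, hcA', hcc] <;> norm_num

/-- The triangles share the side from the center to `A`, on which the second coordinate vanishes. -/
lemma frameDist_round_same_line (h : y ≤ x) (h' : y' ≤ x') (hr : 0 < r) (hc : c ∈ A.1)
    (hc' : c' ∈ A.1) :
    (frameDist (roundVertex c A x y r) (roundVertex c' A x' y' r) : ℝ) ≤
      gap x x' r + gap y 0 r + gap y' 0 r := by
  have hcc : (classDist S c c' : ℝ) ≤ 2 := by exact_mod_cast classDist_le_two A.2 hc hc'
  simp only [gap_eq, roundVertex]
  rcases threshold_cases h r with h1 | h1 | h1 <;> rcases threshold_cases h' r with h2 | h2 | h2 <;>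
    simp [h1, h2, frameDist, hc, hc', hr.not_ge] <;> linarith

lemma frameDist_round_of_mem (h : y ≤ x) (h' : y' ≤ x') (hr : 0 < r) (hA : A ≠ A')
    (hc' : c' ∈ A'.1) (hcA' : c ∈ A'.1) :
    (frameDist (roundVertex c A x y r) (roundVertex c' A' x' y' r) : ℝ) ≤
      gap x 0 r + gap y x' r + gap y' 0 r := by
  have hcc : (classDist S c c' : ℝ) ≤ 2 := by exact_mod_cast classDist_le_two A'.2 hcA' hc'
  simp only [gap_eq, roundVertex]
  rcases threshold_cases h r with h1 | h1 | h1 <;> rcases threshold_cases h' r with h2 | h2 | h2 <;>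
    simp [h1, h2, frameDist, hA, hcA', hr.not_ge] <;> (try split_ifs) <;>
      linarith

lemma frameDist_round_of_classDist_le_two (h : y ≤ x) (h' : y' ≤ x') (hr : 0 < r)
    (hcc : classDist S c c' ≤ 2) :
    (frameDist (roundVertex c A x y r) (roundVertex c' A' x' y' r) : ℝ) ≤
      gap x 0 r + gap y y' r + gap x' 0 r := by
  have hcc : (classDist S c c' : ℝ) ≤ 2 := by exact_mod_cast hcc
  simp only [gap_eq, roundVertex]
  rcases threshold_cases h r with h1 | h1 | h1 <;> rcases threshold_cases h' r with h2 | h2 | h2 <;>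
    simp [h1, h2, frameDist, hr.not_ge] <;> (try split_ifs) <;>
      linarith

lemma frameDist_round_le (h : y ≤ x) (h' : y' ≤ x') (hr : 0 < r) :
    (frameDist (roundVertex c A x y r) (roundVertex c' A' x' y' r) : ℝ) ≤
      gap x 0 r + gap y 0 r + gap x' 0 r + gap y' 0 r := by
  have hcc : (classDist S c c' : ℝ) ≤ 4 := by exact_mod_cast classDist_le_four c c'
  simp only [gap_eq, roundVertex]
  rcases threshold_cases h r with h1 | h1 | h1 <;> rcases threshold_cases h' r with h2 | h2 | h2 <;>
    simp [h1, h2, frameDist, hr.not_ge] <;> (try split_ifs) <;>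
      linarith

end Rounding

/-- The compatibility of the affinities of two points with a distance of at most `δ`. -/
structure IsNear (S : SimpleGraph ι) (a a' : ι → ℝ) (δ : ℝ) : Prop where
  le : ∀ t, a t ≤ a' t + δ
  ge : ∀ t, a' t ≤ a t + δ
  add_le : ∀ s t, a s + a' t ≤ 4 - classDist S s t + δ

namespace IsNear

variable {a a' : ι → ℝ} {δ : ℝ} {c c' : ι} {A A' : anticliques S} {p q p' q' : ℝ}

lemma symm (h : IsNear S a a' δ) : IsNear S a' a δ where
  le := h.ge
  ge := h.le
  add_le s t := by
    have := h.add_le t s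
    rw [classDist_comm] at this
    linarith

lemma nonneg [Nonempty ι] (h : IsNear S a a' δ) : 0 ≤ δ := by
  have t := Classical.arbitrary ι
  linarith [h.le t, h.ge t]

lemma add_le_of_eq_four (h : IsNear S a a' δ) {s t : ι} (hst : classDist S s t = 4) :
    a s + a' t ≤ δ := by
  have := h.add_le s t
  rw [hst] at this
  norm_num at this
  exact this

variable (h : IsNear S a a' δ) (P : IsPosition a c A p q) (P' : IsPosition a' c' A' p' q')

include h P P' in
lemma fst_le_fst : p ≤ p' + δ := by
  have : Nonempty ι := ⟨c⟩
  rcases P.fst_eq with h0 | h0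
  · linarith [P'.nonneg, P'.le, h.nonneg]
  · linarith [h.le c, P'.le_fst c]

include h P P' in
lemma fst_le_snd (hcc : classDist S c' c ≠ 0) : p ≤ q' + δ := by
  have : Nonempty ι := ⟨c⟩
  rcases P.fst_eq with h0 | h0
  · linarith [P'.nonneg, h.nonneg]
  · linarith [h.le c, P'.le_snd c hcc]

include h P P' in
lemma snd_le_snd [Finite ι] (hK : IsKClutter (anticliques S)) (hcc : classDist S c c' = 0) :
    q ≤ q' + δ := by
  have : Nonempty ι := ⟨c⟩
  rcases P.snd_eq with h0 | ⟨t, -, ht, rfl⟩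
  · linarith [P'.nonneg, h.nonneg]
  · have hle := classDist_le_of_classDist_eq_zero hK hcc t
    linarith [h.le t, P'.le_snd t (by omega)]

include h P P' in
-- If neither affinity is clipped to 0, `add_le` applies to `c` and `c'`; otherwise one summand
-- vanishes and `fst_le_fst` bounds the other.
lemma fst_add_fst (hcc : classDist S c c' = 4) : p + p' ≤ δ := by
  have hcc' := (classDist_comm c' c).trans hcc
  rcases P.fst_eq with h0 | h0
  · linarith [h.symm.fst_le_fst P' P]
  · rcases P'.fst_eq with h1 | h1
    · linarith [h.fst_le_fst P P']
    · linarith [h.add_le_of_eq_four hcc]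

include h P P' in
lemma fst_add_snd (hcc : classDist S c' c ≠ 0)
    (hA : ∀ t ∈ A'.1, classDist S c' t ≠ 0 → classDist S c t = 4) : p + q' ≤ δ := by
  rcases P'.snd_eq with h0 | ⟨t, htA, htc, rfl⟩
  · linarith [h.fst_le_snd P P' hcc]
  · rcases P.fst_eq with h1 | h1
    · linarith [h.ge t, P.le_fst t]
    · linarith [h.add_le_of_eq_four (hA t htA htc)]

include h P P' in
-- Terminals realizing `q` and `q'` lie on different anticliques through one class, so they are at
-- distance 4 by `classDist_eq_four`.
lemma snd_add_snd [Finite ι] (hK : IsKClutter (anticliques S)) (hcc : classDist S c c' = 0)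
    (hA : A ≠ A') : q + q' ≤ δ := by
  have hcc' := (classDist_comm c' c).trans hcc
  rcases P.snd_eq with h0 | ⟨t, htA, htc, hqt⟩
  · linarith [h.symm.snd_le_snd P' P hK hcc']
  · rcases P'.snd_eq with h1 | ⟨t', htA', htc', hqt'⟩
    · linarith [h.snd_le_snd P P' hK hcc]
    · have h2 := classDist_le_of_classDist_eq_zero hK hcc' t'
      have h3 := classDist_eq_four hK A.2 A'.2 (Subtype.coe_injective.ne hA) htA P.mem
        (mem_of_classDist_eq_zero hK hcc' A'.2 P'.mem) htA' (by rwa [classDist_comm])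
        (by omega)
      linarith [h.add_le_of_eq_four h3]

end IsNear

section Expectation

open MeasureTheory Set

lemma exists_integrable_bound {f : ℝ → ℝ} {δ u₁ w₁ u₂ w₂ u₃ w₃ u₄ w₄ : ℝ}
    (hu₁ : u₁ ∈ Icc (0 : ℝ) 1) (hw₁ : w₁ ∈ Icc (0 : ℝ) 1) (hu₂ : u₂ ∈ Icc (0 : ℝ) 1)
    (hw₂ : w₂ ∈ Icc (0 : ℝ) 1) (hu₃ : u₃ ∈ Icc (0 : ℝ) 1) (hw₃ : w₃ ∈ Icc (0 : ℝ) 1)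
    (hu₄ : u₄ ∈ Icc (0 : ℝ) 1) (hw₄ : w₄ ∈ Icc (0 : ℝ) 1)
    (hδ : |u₁ - w₁| + |u₂ - w₂| + |u₃ - w₃| + |u₄ - w₄| ≤ δ)
    (hf : ∀ r, 0 < r → f r ≤ gap u₁ w₁ r + gap u₂ w₂ r + gap u₃ w₃ r + gap u₄ w₄ r) :
    ∃ h : ℝ → ℝ, IntegrableOn h (Ioc 0 1) ∧ ∫ r in Ioc (0 : ℝ) 1, h r ≤ δ ∧
      ∀ r ∈ Ioc (0 : ℝ) 1, f r ≤ h r := by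
  have i₁ := integrableOn_gap u₁ w₁
  have i₂ := integrableOn_gap u₂ w₂
  have i₃ := integrableOn_gap u₃ w₃
  have i₄ := integrableOn_gap u₄ w₄
  refine ⟨gap u₁ w₁ + gap u₂ w₂ + gap u₃ w₃ + gap u₄ w₄,
    ((i₁.add i₂).add i₃).add i₄, ?_, fun r hr => hf r hr.1⟩
  rw [integral_add' ((i₁.add i₂).add i₃) i₄, integral_add' (i₁.add i₂) i₃, integral_add' i₁ i₂,
    integral_gap hu₁ hw₁, integral_gap hu₂ hw₂, integral_gap hu₃ hw₃, integral_gap hu₄ hw₄]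
  exact hδ

lemma gap_self (x r : ℝ) : gap x x r = 0 := by simp [gap]

/-- Rounding points of the folder complex at a common random threshold does not increase their
expected distance. -/
lemma IsNear.exists_integrable_bound [Finite ι] (hK : IsKClutter (anticliques S))
    {a a' : ι → ℝ} {δ : ℝ} {c c' : ι} {A A' : anticliques S} {p q p' q' : ℝ}
    (h : IsNear S a a' δ) (P : IsPosition a c A p q) (P' : IsPosition a' c' A' p' q') :
    ∃ g : ℝ → ℝ, IntegrableOn g (Ioc 0 1) ∧ ∫ r in Ioc (0 : ℝ) 1, g r ≤ δ ∧
      ∀ r ∈ Ioc (0 : ℝ) 1, (frameDist (roundVertex c A ((p + q) / 2) ((p - q) / 2) r)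
        (roundVertex c' A' ((p' + q') / 2) ((p' - q') / 2) r) : ℝ) ≤ g r := by
  have b := P.nonneg
  have b' := P'.nonneg
  have l := P.le
  have l' := P'.le
  have m := P.add_le
  have m' := P'.add_le
  have hxy : (p - q) / 2 ≤ (p + q) / 2 := by linarith
  have hxy' : (p' - q') / 2 ≤ (p' + q') / 2 := by linarith
  have z0 : (0 : ℝ) ∈ Icc (0 : ℝ) 1 := by simp
  have hx : (p + q) / 2 ∈ Icc (0 : ℝ) 1 := ⟨by linarith, by linarith⟩
  have hy : (p - q) / 2 ∈ Icc (0 : ℝ) 1 := ⟨by linarith, by linarith⟩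
  have hx' : (p' + q') / 2 ∈ Icc (0 : ℝ) 1 := ⟨by linarith, by linarith⟩
  have hy' : (p' - q') / 2 ∈ Icc (0 : ℝ) 1 := ⟨by linarith, by linarith⟩
  have f1 := h.fst_le_fst P P'
  have f2 := h.symm.fst_le_fst P' P
  -- With `x = (p + q) / 2` and `y = (p - q) / 2`, the sum `|x - x'| + |y - y'|` is the maximum of
  -- `|p - p'|` and `|q - q'|`. In every case below the sum of the gaps reduces in this way to the
  -- bounds on affinities.
  by_cases hcc : classDist S c c' = 0
  · have hcc' := (classDist_comm c' c).trans hcc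
    by_cases hA : A = A'
    · subst hA
      refine PathPacking.exists_integrable_bound hx hx' hy hy' z0 z0 z0 z0 ?_ fun r hr => ?_
      · have f3 := h.snd_le_snd P P' hK hcc
        have f4 := h.symm.snd_le_snd P' P hK hcc'
        simp only [sub_self, abs_zero, add_zero]
        rcases abs_cases ((p + q) / 2 - (p' + q') / 2) with h1 | h1 <;>
          rcases abs_cases ((p - q) / 2 - (p' - q') / 2) with h2 | h2 <;> linarith
      · simp only [gap_self, add_zero]
        exact frameDist_round_same_triangle hxy hxy' P.mem P'.mem hcc
    · refine PathPacking.exists_integrable_bound hx hy' hy hx' z0 z0 z0 z0 ?_ fun r hr => ?_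
      · have f3 := h.snd_add_snd P P' hK hcc hA
        simp only [sub_self, abs_zero, add_zero]
        rcases abs_cases ((p + q) / 2 - (p' - q') / 2) with h1 | h1 <;>
          rcases abs_cases ((p - q) / 2 - (p' + q') / 2) with h2 | h2 <;> linarith
      · simp only [gap_self, add_zero]
        exact frameDist_round_same_class hxy hxy' hA
          (mem_of_classDist_eq_zero hK hcc' A'.2 P'.mem)
          (mem_of_classDist_eq_zero hK hcc A.2 P.mem) hcc
  have hcc' : classDist S c' c ≠ 0 := by rwa [classDist_comm]
  have f3 := h.fst_le_snd P P' hcc'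
  have f4 := h.symm.fst_le_snd P' P hcc
  by_cases hA : A = A'
  · subst hA
    refine PathPacking.exists_integrable_bound hx hx' hy z0 hy' z0 z0 z0 ?_ fun r hr => ?_
    · simp only [sub_zero, abs_zero, add_zero]
      rw [abs_of_nonneg hy.1, abs_of_nonneg hy'.1]
      rcases abs_cases ((p + q) / 2 - (p' + q') / 2) with h1 | h1 <;> linarith
    · simp only [gap_self, add_zero]
      exact frameDist_round_same_line hxy hxy' hr P.mem P'.mem
  have hA' : A.1 ≠ A'.1 := Subtype.coe_injective.ne hA
  by_cases hcA' : c ∈ A'.1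
  · have f5 := h.symm.fst_add_snd P' P hcc fun t ht htc => by
      rw [classDist_comm]
      exact classDist_eq_four hK A.2 A'.2 hA' ht P.mem hcA' P'.mem (by rwa [classDist_comm]) hcc
    refine PathPacking.exists_integrable_bound hx z0 hy hx' hy' z0 z0 z0 ?_ fun r hr => ?_
    · simp only [sub_zero, abs_zero, add_zero]
      rw [abs_of_nonneg hx.1, abs_of_nonneg hy'.1]
      rcases abs_cases ((p - q) / 2 - (p' + q') / 2) with h1 | h1 <;> linarith
    · simp only [gap_self, add_zero]
      exact frameDist_round_of_mem hxy hxy' hr hA P'.mem hcA'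
  by_cases hcA : c' ∈ A.1
  · have f5 := h.fst_add_snd P P' hcc' fun t ht htc => by
      rw [classDist_comm]
      exact classDist_eq_four hK A'.2 A.2 hA'.symm ht P'.mem hcA P.mem (by rwa [classDist_comm])
        hcc'
    refine PathPacking.exists_integrable_bound hx' z0 hy' hx hy z0 z0 z0 ?_ fun r hr => ?_
    · simp only [sub_zero, abs_zero, add_zero]
      rw [abs_of_nonneg hx'.1, abs_of_nonneg hy.1]
      rcases abs_cases ((p' - q') / 2 - (p + q) / 2) with h1 | h1 <;> linarith
    · simp only [gap_self, add_zero]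
      rw [frameDist_comm]
      exact frameDist_round_of_mem hxy' hxy hr (Ne.symm hA) P.mem hcA
  by_cases h4 : classDist S c c' = 4
  · have f5 := h.fst_add_fst P P' h4
    refine PathPacking.exists_integrable_bound hx z0 hy z0 hx' z0 hy' z0 ?_ fun r hr =>
      frameDist_round_le hxy hxy' hr
    simp only [sub_zero]
    rw [abs_of_nonneg hx.1, abs_of_nonneg hy.1, abs_of_nonneg hx'.1, abs_of_nonneg hy'.1]
    linarith
  -- The classes meet in a third anticlique `B`, different from `A` and `A'`.
  · have hlt : classDist S c c' < 4 := lt_of_le_of_ne (classDist_le_four c c') h4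
    obtain ⟨B, hB, hcB, hcB'⟩ := exists_anticlique_of_classDist_lt hlt
    have f5 := h.fst_add_snd P P' hcc' fun t ht htc =>
      classDist_eq_four hK hB A'.2 (fun hBA => hcA' (hBA ▸ hcB)) hcB hcB' P'.mem ht hcc htc
    have f6 := h.symm.fst_add_snd P' P hcc fun t ht htc =>
      classDist_eq_four hK hB A.2 (fun hBA => hcA (hBA ▸ hcB')) hcB' hcB P.mem ht hcc' htc
    refine PathPacking.exists_integrable_bound hx z0 hy hy' hx' z0 z0 z0 ?_ fun r hr => ?_
    · simp only [sub_zero, abs_zero, add_zero]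
      rw [abs_of_nonneg hx.1, abs_of_nonneg hx'.1]
      rcases abs_cases ((p - q) / 2 - (p' - q') / 2) with h1 | h1 <;> linarith
    · simp only [gap_self, add_zero]
      exact frameDist_round_of_classDist_le_two hxy hxy' hr (classDist_le_two hB hcB hcB')

end Expectation

/-- The position of a terminal is rounded to its own class at every threshold. -/
lemma IsPosition.exists_round_eq {a : ι → ℝ} {c : ι} {A : anticliques S} {p q : ℝ}
    (P : IsPosition a c A p q) {t : ι} (ht : a t = 2) {r : ℝ} (hr : r ≤ 1) :
    roundVertex c A ((p + q) / 2) ((p - q) / 2) r = .terminal c ∧ classDist S c t = 0 := by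
  have h1 := P.le_fst t
  have h2 := P.nonneg
  have h3 := P.add_le
  -- Affinity 2 forces `p = 2` and `q = 0`, so both coordinates equal 1.
  constructor
  · rw [roundVertex, if_pos (by linarith)]
  · by_contra hne
    linarith [P.le_snd t hne]

end Position

/-! ### Sums over edges and over ordered pairs of nodes -/

section Counting

variable {α β : Type*} {G : Graph α β} {V : Finset α} {E : Finset β}

open Classical in
/-- The sum of `g x y` over the ordered pairs `(x, y)` of ends of `e`. -/
def edgeSum {R : Type*} [AddCommMonoid R] (G : Graph α β) (V : Finset α) (g : α → α → R)
    (e : β) : R :=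
  ∑ x ∈ V, ∑ y ∈ V, if G.IsLink e x y then g x y else 0

lemma edgeSum_of_isLoopAt {R : Type*} [AddCommMonoid R] (hV : (V : Set α) = V(G))
    (g : α → α → R) {e : β} {x : α} (he : G.IsLink e x x) : edgeSum G V g e = g x x := by
  classical
  have hx : x ∈ V := by rw [← Finset.mem_coe, hV]; exact he.left_mem
  have h : ∀ u v, (if G.IsLink e u v then g u v else 0) =
      if x = u then (if x = v then g u v else 0) else 0 := by
    intro u v
    simp only [he.isLink_iff, and_comm (a := x = v), or_self, ← ite_and]
  simp [edgeSum, h, hx]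

lemma edgeSum_of_isLink {R : Type*} [AddCommMonoid R] (hV : (V : Set α) = V(G))
    (g : α → α → R) {e : β} {x y : α} (he : G.IsLink e x y) (hxy : x ≠ y) :
    edgeSum G V g e = g x y + g y x := by
  classical
  have hx : x ∈ V := by rw [← Finset.mem_coe, hV]; exact he.left_mem
  have hy : y ∈ V := by rw [← Finset.mem_coe, hV]; exact he.right_mem
  have h : ∀ u v, (if G.IsLink e u v then g u v else 0) =
      (if x = u then (if y = v then g u v else 0) else 0) +
      (if y = u then (if x = v then g u v else 0) else 0) := by
    intro u v
    rw [he.isLink_iff]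
    by_cases h1 : x = u
    · have h2 : ¬ y = u := fun h2 => hxy (h1.trans h2.symm)
      simp [h1, h2]
    · by_cases h2 : y = u <;> simp [h1, h2, and_comm]
  simp only [edgeSum, h, Finset.sum_add_distrib]
  simp [hx, hy]

lemma edgeSum_nonneg {g : α → α → ℝ} (hg : ∀ x y, 0 ≤ g x y) (e : β) : 0 ≤ edgeSum G V g e :=
  Finset.sum_nonneg fun x _ => Finset.sum_nonneg fun y _ => by split_ifs <;> simp [hg]

lemma edgeSum_frameDist {ι : Type*} {S : SimpleGraph ι} (hV : (V : Set α) = V(G))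
    (φ : α → FrameVertex S) {e : β} {x y : α} (he : G.IsLink e x y) :
    edgeSum G V (fun x y => frameDist (φ x) (φ y)) e = 2 * frameDist (φ x) (φ y) := by
  by_cases hxy : x = y
  · subst hxy
    rw [edgeSum_of_isLoopAt hV _ he, frameDist_self]
  · rw [edgeSum_of_isLink hV _ he hxy, frameDist_comm (φ y), two_mul]

lemma edgeSum_natCast (g : α → α → ℕ) (e : β) :
    edgeSum G V (fun x y => (g x y : ℝ)) e = (edgeSum G V g e : ℕ) := by
  simp only [edgeSum]
  push_cast
  rfl

lemma edgeCount_eq_sum [DecidableEq β] (hE : (E : Set β) = E(G)) (x y : α)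
    [DecidablePred fun e => G.IsLink e x y] :
    edgeCount G x y = ∑ e ∈ E, if G.IsLink e x y then 1 else 0 := by
  rw [Finset.sum_boole, Nat.cast_id, ← Set.ncard_coe_finset, edgeCount]
  congr 1
  ext e
  have : G.IsLink e x y → e ∈ E := fun h => by rw [← Finset.mem_coe, hE]; exact h.edge_mem
  simpa using this

lemma edgeCount_comm (x y : α) : edgeCount G x y = edgeCount G y x := by
  simp only [edgeCount, G.isLink_comm (x := x)]

lemma sum_edgeCount_mul {R : Type*} [CommSemiring R] (hE : (E : Set β) = E(G)) (g : α → α → R) :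
    ∑ x ∈ V, ∑ y ∈ V, (edgeCount G x y : R) * g x y = ∑ e ∈ E, edgeSum G V g e := by
  classical
  simp only [edgeSum]
  rw [Finset.sum_comm (s := E)]
  simp_rw [Finset.sum_comm (s := E)]
  refine Finset.sum_congr rfl fun x _ => Finset.sum_congr rfl fun y _ => ?_
  rw [edgeCount_eq_sum hE]
  push_cast
  rw [Finset.sum_mul]
  simp

lemma TPath.sum_traversals_mul {T : Set α} (P : TPath G T) (g : α → α → ℝ) :
    ∑ x ∈ V, ∑ y ∈ V, (P.traversals x y : ℝ) * g x y = (P.edges.map (edgeSum G V g)).sum := by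
  classical
  rw [← List.sum_toFinset _ P.nodup]
  change _ = ∑ e ∈ P.edges.toFinset, ∑ x ∈ V, ∑ y ∈ V, if G.IsLink e x y then g x y else 0
  rw [Finset.sum_comm (s := P.edges.toFinset)]
  simp_rw [Finset.sum_comm (s := P.edges.toFinset)]
  refine Finset.sum_congr rfl fun x _ => Finset.sum_congr rfl fun y _ => ?_
  have h : P.traversals x y = ((P.edges.toFinset).filter fun e => G.IsLink e x y).card := by
    rw [← Set.ncard_coe_finset, TPath.traversals]
    congr 1
    ext e
    simp
  rw [h, Finset.card_filter]
  push_cast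
  rw [Finset.sum_mul]
  simp

lemma degree_eq_sum (hV : (V : Set α) = V(G)) (hE : (E : Set β) = E(G)) (x : α) :
    degree G x = ∑ y ∈ V, edgeCount G x y + edgeCount G x x := by
  classical
  have h : (G.incidenceSet x).ncard = ∑ y ∈ V, edgeCount G x y := by
    simp only [edgeCount_eq_sum hE]
    rw [Finset.sum_comm]
    have hcard : G.incidenceSet x = (E.filter fun e => G.Inc e x : Finset β) := by
      ext e
      have : G.Inc e x → e ∈ E := fun h => by rw [← Finset.mem_coe, hE]; exact h.edge_mem
      simpa using this
    rw [hcard, Set.ncard_coe_finset, Finset.card_filter]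
    refine Finset.sum_congr rfl fun e _ => ?_
    split_ifs with he
    · obtain ⟨z, hz⟩ := he
      have hzV : z ∈ V := by rw [← Finset.mem_coe, hV]; exact hz.right_mem
      simp [hz.isLink_iff_eq, hzV]
    · rw [Finset.sum_eq_zero]
      intro y _
      rw [if_neg]
      exact fun hy => he hy.inc_left
  rw [degree, h]
  rfl

end Counting

/-! ### The frame cost and its parity -/

section Cost

variable {α β ι : Type*} {G : Graph α β} {V : Finset α} {E : Finset β} {S : SimpleGraph ι}

/-- Twice the total length of the edges of `G` under a map of its nodes to the frame. -/
def frameCost (G : Graph α β) (V : Finset α) (φ : α → FrameVertex S) : ℕ :=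
  ∑ x ∈ V, ∑ y ∈ V, edgeCount G x y * frameDist (φ x) (φ y)

lemma frameCost_eq_sum (hE : (E : Set β) = E(G)) (φ : α → FrameVertex S) :
    frameCost G V φ = ∑ e ∈ E, edgeSum G V (fun x y => frameDist (φ x) (φ y)) e := by
  simpa [frameCost] using sum_edgeCount_mul (R := ℕ) (V := V) hE fun x y => frameDist (φ x) (φ y)

/-- If the nodes on lines have even degree, the frame cost is divisible by four. -/
lemma four_dvd_frameCost (hV : (V : Set α) = V(G)) (hE : (E : Set β) = E(G))
    (φ : α → FrameVertex S) (hdeg : ∀ x ∈ V, (φ x).isLine → Even (degree G x)) :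
    4 ∣ frameCost G V φ := by
  classical
  let h (x : α) : ℕ := if (φ x).isLine then 1 else 0
  -- `edgeSum` visits a loop only once; the diagonal term makes it count twice, as in the degree.
  let g (x y : α) : ℕ := h x + if x = y then h x else 0
  have hedge : ∀ e ∈ E, edgeSum G V (fun x y => frameDist (φ x) (φ y)) e ≡
      2 * edgeSum G V g e [MOD 4] := by
    intro e he
    rw [← Finset.mem_coe, hE] at he
    obtain ⟨x, y, hxy⟩ := G.exists_isLink_of_mem_edgeSet he
    rw [edgeSum_frameDist hV φ hxy]
    refine Nat.ModEq.mul_left' (c := 2) (n := 2) ?_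
    have hmod : frameDist (φ x) (φ y) ≡ h x + h y [MOD 2] := frameDist_mod_two (φ x) (φ y)
    by_cases hne : x = y
    · subst hne
      simpa [edgeSum_of_isLoopAt hV g hxy, g] using hmod
    · simpa [edgeSum_of_isLink hV g hxy hne, g, hne, Ne.symm hne] using hmod
  have hsum : ∑ e ∈ E, edgeSum G V g e = ∑ x ∈ V, h x * degree G x := by
    rw [← sum_edgeCount_mul (R := ℕ) hE]
    refine Finset.sum_congr rfl fun x hx => ?_
    simp only [g, mul_add, Finset.sum_add_distrib, degree_eq_sum hV hE x, Nat.cast_id, mul_ite,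
      mul_zero, Finset.sum_ite_eq, hx, if_true, Finset.mul_sum]
    congr 1
    · exact Finset.sum_congr rfl fun y _ => mul_comm _ _
    · exact mul_comm _ _
  have heven : 2 ∣ ∑ x ∈ V, h x * degree G x := by
    refine Finset.dvd_sum fun x hx => ?_
    by_cases hl : (φ x).isLine
    · simpa [h, hl] using (hdeg x hx hl).two_dvd
    · simp [h, hl]
  rw [frameCost_eq_sum hE, ← Nat.modEq_zero_iff_dvd]
  have h1 : ∑ e ∈ E, edgeSum G V (fun x y => frameDist (φ x) (φ y)) e ≡
      ∑ e ∈ E, 2 * edgeSum G V g e [MOD 4] := by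
    unfold Nat.ModEq
    rw [Finset.sum_nat_mod, Finset.sum_nat_mod _ _ fun e => 2 * edgeSum G V g e]
    rw [Finset.sum_congr rfl fun e he => hedge e he]
  refine h1.trans ?_
  rw [← Finset.mul_sum, hsum, Nat.modEq_zero_iff_dvd]
  exact mul_dvd_mul_left 2 heven

end Cost

/-! ### Linear programming duality by separation -/

section LinearProgramming

/-- Strong duality for packing problems with positive capacities. -/
lemma exists_dual_of_packing_le {I J : Type*} [Fintype I] (A : J → I → ℝ) (b : J → ℝ) (c : I → ℝ)
    (hc : ∀ i, 0 < c i) (θ : ℝ)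
    (hθ : ∀ f : J →₀ ℝ, (∀ j, 0 ≤ f j) → (∀ i, (f.sum fun j w => w * A j i) ≤ c i) →
      (f.sum fun j w => w * b j) ≤ θ) :
    ∃ l : I → ℝ, (∀ i, 0 ≤ l i) ∧ (∀ j, b j ≤ ∑ i, A j i * l i) ∧ ∑ i, c i * l i ≤ θ := by
  classical
  let L : (J →₀ ℝ) →ₗ[ℝ] (I → ℝ) × ℝ := Finsupp.linearCombination ℝ fun j => (A j, b j)
  have hL1 : ∀ f i, (L f).1 i = f.sum fun j w => w * A j i := by
    intro f i
    simp [L, Finsupp.linearCombination_apply, Finsupp.sum, Prod.fst_sum]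
  have hL2 : ∀ f, (L f).2 = f.sum fun j w => w * b j := by
    intro f
    simp [L, Finsupp.linearCombination_apply, Finsupp.sum, Prod.snd_sum]
  -- By `hθ`, the convex cone of attainable pairs of load and value avoids the open set of pairs
  -- with load below capacity and value above `θ`. A separating functional, normalized, is the dual
  -- solution.
  let U : Set ((I → ℝ) × ℝ) := (Set.univ.pi fun i => Set.Iio (c i)) ×ˢ Set.Ioi θ
  have hUconv : Convex ℝ U := (convex_pi fun i _ => convex_Iio _).prod (convex_Ioi _)
  have hUopen : IsOpen U := (isOpen_set_pi Set.finite_univ fun i _ => isOpen_Iio).prod isOpen_Ioi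
  have hZconv : Convex ℝ (L '' {f | ∀ j, 0 ≤ f j}) := by
    apply Convex.linear_image
    intro f hf g hg u w hu hw _ j
    simp only [Finsupp.add_apply, Finsupp.smul_apply, smul_eq_mul]
    have := hf j
    have := hg j
    positivity
  have hdisj : Disjoint U (L '' {f | ∀ j, 0 ≤ f j}) := by
    rw [Set.disjoint_left]
    rintro _ ⟨h1, h2⟩ ⟨f, hf, rfl⟩
    refine absurd (hθ f hf fun i => ?_) (not_le.2 ?_)
    · rw [← hL1]
      exact (h1 i trivial).le
    · rw [← hL2]
      exact h2
  obtain ⟨F, s, hFU, hFZ⟩ := geometric_hahn_banach_open hUconv hUopen hZconv hdisj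
  set m : I → ℝ := fun i => F (Pi.single i 1, 0) with hm
  set k : ℝ := F (0, 1) with hk
  have hF : ∀ (z : I → ℝ) (r : ℝ), F (z, r) = ∑ i, z i * m i + r * k := by
    intro z r
    have : (z, r) = ∑ i, z i • ((Pi.single i 1, 0) : (I → ℝ) × ℝ) + r • ((0, 1) : (I → ℝ) × ℝ) := by
      ext i
      · simp [Prod.fst_sum, Pi.single_apply]
      · simp [Prod.snd_sum]
    rw [this, map_add, map_sum, map_smul]
    simp only [map_smul, smul_eq_mul, hm, hk]
  have hs : s ≤ 0 := by simpa using hFZ (L 0) ⟨0, by simp, rfl⟩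
  have hUmem : ∀ (z : I → ℝ) (r : ℝ), (∀ i, z i < c i) → θ < r → ∑ i, z i * m i + r * k < 0 := by
    intro z r hz hr
    rw [← hF]
    exact (hFU (z, r) ⟨fun i _ => hz i, hr⟩).trans_le hs
  have hk0 : k < 0 := by
    have h1 := hUmem 0 (max θ 0 + 1) hc (by linarith [le_max_left θ 0])
    have h2 : (0 : ℝ) < max θ 0 + 1 := by linarith [le_max_right θ 0]
    simp only [Pi.zero_apply, zero_mul, Finset.sum_const_zero, zero_add] at h1
    by_contra! hk
    nlinarith [mul_nonneg h2.le hk]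
  have hm0 : ∀ i, 0 ≤ m i := by
    intro i
    by_contra! hneg
    obtain ⟨n, hn⟩ := exists_nat_gt (((θ + 1) * k) / m i)
    have h1 := hUmem (Pi.single i (-(n : ℝ))) (θ + 1) (fun i' => ?_) (by linarith)
    · rw [Finset.sum_eq_single i (fun j _ hj => by simp [hj]) (by simp)] at h1
      simp only [Pi.single_eq_same] at h1
      rw [div_lt_iff_of_neg hneg] at hn
      linarith
    · rcases eq_or_ne i' i with rfl | hne
      · simp only [Pi.single_eq_same]
        linarith [hc i', (Nat.cast_nonneg n : (0 : ℝ) ≤ n)]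
      · simpa [hne] using hc i'
  have hA : ∀ j, 0 ≤ ∑ i, A j i * m i + b j * k := by
    intro j
    rw [← hF]
    by_contra! hneg
    obtain ⟨n, hn⟩ := exists_nat_gt (s / F (A j, b j))
    have h1 := hFZ (L (Finsupp.single j n)) ⟨_, fun j' => ?_, rfl⟩
    · simp only [L, Finsupp.linearCombination_single, map_smul, smul_eq_mul] at h1
      rw [div_lt_iff_of_neg hneg] at hn
      linarith
    · rw [Finsupp.single_apply]
      split_ifs <;> simp
  -- The point `(c, θ)` is only on the boundary of `U`, hence the limit.
  have hcl : ∑ i, c i * m i + θ * k ≤ 0 := by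
    have hcont : Filter.Tendsto (fun ε : ℝ => ∑ i, (c i - ε) * m i + (θ + ε) * k)
        (nhdsWithin 0 (Set.Ioi 0)) (nhds (∑ i, (c i - 0) * m i + (θ + 0) * k)) :=
      (Continuous.tendsto (by fun_prop) 0).mono_left nhdsWithin_le_nhds
    simp only [sub_zero, add_zero] at hcont
    refine le_of_tendsto hcont ?_
    filter_upwards [self_mem_nhdsWithin] with ε hε
    have hε : 0 < ε := hε
    exact (hUmem (fun i => c i - ε) (θ + ε) (fun i => by linarith) (by linarith)).le
  refine ⟨fun i => m i / -k, fun i => div_nonneg (hm0 i) (by linarith), fun j => ?_, ?_⟩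
  · simp only [← mul_div_assoc]
    rw [← Finset.sum_div, le_div_iff₀ (by linarith)]
    linarith [hA j]
  · simp only [← mul_div_assoc]
    rw [← Finset.sum_div, div_le_iff₀ (by linarith)]
    linarith

end LinearProgramming

/-! ### Walks and trails -/

section Walks

variable {α β : Type*} {G : Graph α β} {u v w : α} {es fs : List β}

lemma IsWalk.left_mem (h : IsWalk G u es v) : u ∈ V(G) := by
  cases h with
  | nil hx => exact hx
  | cons he _ => exact he.left_mem

lemma IsWalk.append (h : IsWalk G u es v) (h' : IsWalk G v fs w) : IsWalk G u (es ++ fs) w := by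
  induction h with
  | nil _ => exact h'
  | cons he _ ih => exact .cons he (ih h')

lemma IsWalk.reverse (h : IsWalk G u es v) : IsWalk G v es.reverse u := by
  induction h with
  | nil hx => exact .nil hx
  | cons he _ ih =>
    rw [List.reverse_cons]
    exact ih.append (.cons he.symm (.nil he.left_mem))

lemma IsWalk.exists_of_append (h : IsWalk G u (es ++ fs) v) :
    ∃ w, IsWalk G u es w ∧ IsWalk G w fs v := by
  induction es generalizing u with
  | nil => exact ⟨u, .nil h.left_mem, h⟩
  | cons e es ih =>
    cases h with
    | cons he hes =>
      obtain ⟨w, h1, h2⟩ := ih hes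
      exact ⟨w, .cons he h1, h2⟩

lemma IsWalk.mem_edgeSet (h : IsWalk G u es v) : ∀ e ∈ es, e ∈ E(G) := by
  induction h with
  | nil _ => simp
  | cons he _ ih => simpa using ⟨he.edge_mem, ih⟩

lemma IsWalk.ne_nil (h : IsWalk G u es v) (huv : u ≠ v) : es ≠ [] := by
  cases h with
  | nil _ => exact absurd rfl huv
  | cons _ _ => simp

/-- Every walk can be shortened to a trail. -/
lemma IsWalk.exists_nodup (h : IsWalk G u es v) {L : β → ℝ} (hL : ∀ e, 0 ≤ L e) :
    ∃ fs, IsWalk G u fs v ∧ fs.Nodup ∧ (fs.map L).sum ≤ (es.map L).sum := by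
  induction h with
  | nil hx => exact ⟨[], .nil hx, List.nodup_nil, le_rfl⟩
  | @cons x y z e es he hes ih =>
    obtain ⟨fs, hfs, hnd, hle⟩ := ih
    -- If `e` recurs, everything before the recurrence is cut off; the direction of the later
    -- traversal decides whether `e` is kept.
    by_cases hmem : e ∈ fs
    · obtain ⟨l₁, l₂, rfl⟩ := List.append_of_mem hmem
      have hl₁ : 0 ≤ (l₁.map L).sum := List.sum_nonneg (by simpa using fun e _ => hL e)
      have hnd₂ := hnd.of_append_right
      obtain ⟨p, -, hp⟩ := hfs.exists_of_append
      simp only [List.map_append, List.map_cons, List.sum_append, List.sum_cons] at hle ⊢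
      have hp' := hp
      cases hp with
      | cons he' hes' =>
        rcases he.eq_and_eq_or_eq_and_eq he' with ⟨rfl, rfl⟩ | ⟨rfl, rfl⟩
        · refine ⟨e :: l₂, hp', hnd₂, ?_⟩
          simp only [List.map_cons, List.sum_cons]
          linarith [hL e]
        · exact ⟨l₂, hes', hnd₂.of_cons, by linarith [hL e]⟩
    · refine ⟨e :: fs, .cons he hfs, List.nodup_cons.2 ⟨hmem, hnd⟩, ?_⟩
      simp only [List.map_cons, List.sum_cons]
      linarith

lemma IsWalk.frameDist_le {ι : Type*} [Finite ι] {S : SimpleGraph ι}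
    (hK : IsKClutter (anticliques S)) {V : Finset α} (hV : (V : Set α) = V(G))
    (φ : α → FrameVertex S) (h : IsWalk G u es v) :
    2 * (frameDist (φ u) (φ v) : ℝ) ≤
      (es.map (edgeSum G V fun x y => (frameDist (φ x) (φ y) : ℝ))).sum := by
  induction h with
  | nil _ => simp [frameDist_self]
  | @cons x y z e es he _ ih =>
    have h1 : (frameDist (φ x) (φ z) : ℝ) ≤ frameDist (φ x) (φ y) + frameDist (φ y) (φ z) := by
      exact_mod_cast frameDist_triangle hK (φ x) (φ y) (φ z)
    simp only [List.map_cons, List.sum_cons]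
    rw [edgeSum_natCast (fun x y => frameDist (φ x) (φ y)), edgeSum_frameDist hV φ he]
    push_cast
    linarith

end Walks

/-! ### Affinities from a length function -/

section Affinity

variable {α β : Type*} {G : Graph α β} {T : Set α} {S : SimpleGraph T}

/-- The lengths of the walks from `v` to `t`, cut off at `4`. -/
def walkLengths (G : Graph α β) (L : β → ℝ) (v t : α) : Set ℝ :=
  insert 4 {r | ∃ es, IsWalk G v es t ∧ r = (es.map L).sum}

/-- Two minus the distance of `v` from `t`. -/
def affinity (G : Graph α β) (L : β → ℝ) (v t : α) : ℝ :=
  2 - sInf (walkLengths G L v t)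

variable {L : β → ℝ} (hL : ∀ e, 0 ≤ L e)

include hL in
lemma walkLengths_nonneg {v t : α} {r : ℝ} (hr : r ∈ walkLengths G L v t) : 0 ≤ r := by
  rcases hr with rfl | ⟨es, -, rfl⟩
  · norm_num
  · exact List.sum_nonneg (by simpa using fun e _ => hL e)

include hL in
lemma bddBelow_walkLengths (v t : α) : BddBelow (walkLengths G L v t) :=
  ⟨0, fun _ hr => walkLengths_nonneg hL hr⟩

lemma walkLengths_nonempty (v t : α) : (walkLengths G L v t).Nonempty := ⟨4, Or.inl rfl⟩

include hL in
lemma affinity_self {t : α} (ht : t ∈ V(G)) : affinity G L t t = 2 := by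
  have h1 : sInf (walkLengths G L t t) ≤ 0 :=
    csInf_le (bddBelow_walkLengths hL t t) (Or.inr ⟨[], .nil ht, by simp⟩)
  have h2 : 0 ≤ sInf (walkLengths G L t t) :=
    le_csInf (walkLengths_nonempty t t) fun _ hr => walkLengths_nonneg hL hr
  rw [affinity, le_antisymm h1 h2, sub_zero]

include hL in
lemma affinity_le_of_isLink {e : β} {x y : α} (he : G.IsLink e x y) (t : α) :
    affinity G L y t ≤ affinity G L x t + L e := by
  have h : sInf (walkLengths G L x t) - L e ≤ sInf (walkLengths G L y t) := by
    refine le_csInf (walkLengths_nonempty y t) ?_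
    rintro r (rfl | ⟨es, hes, rfl⟩)
    · have := csInf_le (bddBelow_walkLengths (G := G) hL x t) (Or.inl rfl)
      linarith [hL e]
    · have := csInf_le (bddBelow_walkLengths (G := G) hL x t) (Or.inr ⟨e :: es, .cons he hes, rfl⟩)
      simp only [List.map_cons, List.sum_cons] at this
      linarith
  unfold affinity
  linarith

include hL in
-- Walks from `v` to `s` and `t` join to a walk from `s` to `t`, which shortens to a `T`-path. The
-- cut-off value 4 alone is at least any class distance.
lemma affinity_add_affinity_le
    (hP : ∀ P : TPath G T, (classDist S P.source P.target : ℝ) ≤ (P.edges.map L).sum)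
    (v : α) (s t : T) : affinity G L v s + affinity G L v t ≤ 4 - classDist S s t := by
  have h4 : (classDist S s t : ℝ) ≤ 4 := by exact_mod_cast classDist_le_four s t
  have h : ∀ r₁ ∈ walkLengths G L v s, ∀ r₂ ∈ walkLengths G L v t, classDist S s t ≤ r₁ + r₂ := by
    intro r₁ hr₁ r₂ hr₂
    have h1 := walkLengths_nonneg hL hr₁
    have h2 := walkLengths_nonneg hL hr₂
    rcases hr₁ with rfl | ⟨es, hes, rfl⟩
    · linarith
    rcases hr₂ with rfl | ⟨fs, hfs, rfl⟩
    · linarith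
    by_cases hst : s = t
    · subst hst
      rw [classDist_self, Nat.cast_zero]
      linarith
    obtain ⟨gs, hgs, hnd, hle⟩ := (hes.reverse.append hfs).exists_nodup hL
    refine (hP ⟨s, t, gs, hst, hgs, hnd⟩).trans (hle.trans ?_)
    simp
  have h' : classDist S s t ≤ sInf (walkLengths G L v s) + sInf (walkLengths G L v t) := by
    rw [← sub_le_iff_le_add]
    refine le_csInf (walkLengths_nonempty v s) fun r₁ hr₁ => ?_
    rw [sub_le_comm]
    refine le_csInf (walkLengths_nonempty v t) fun r₂ hr₂ => ?_
    linarith [h r₁ hr₁ r₂ hr₂]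
  unfold affinity
  linarith

include hL in
lemma isNear_affinity
    (hP : ∀ P : TPath G T, (classDist S P.source P.target : ℝ) ≤ (P.edges.map L).sum)
    {e : β} {x y : α} (he : G.IsLink e x y) :
    IsNear S (fun t : T => affinity G L x t) (fun t => affinity G L y t) (L e) where
  le t := affinity_le_of_isLink hL he.symm t
  ge t := affinity_le_of_isLink hL he t
  add_le s t := by
    have h1 := affinity_add_affinity_le hL hP x s t
    have h2 := affinity_le_of_isLink hL he (t : α)
    linarith

end Affinity

/-! ### Weak and strong duality with frame maps -/

section Duality

variable {α β : Type*} {G : Graph α β} {T : Set α} {S : SimpleGraph T} {V : Finset α}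
  {E : Finset β}

/-- A map of the nodes to the frame that takes each terminal to its own class. -/
def IsFrameMap (S : SimpleGraph T) (φ : α → FrameVertex S) : Prop :=
  ∀ t : T, ∃ c, φ t = .terminal c ∧ classDist S c t = 0

lemma IsFrameMap.classDist_le [Finite T] (hK : IsKClutter (anticliques S))
    {φ : α → FrameVertex S} (hφ : IsFrameMap S φ) (s t : T) :
    classDist S s t ≤ frameDist (φ s) (φ t) := by
  obtain ⟨c, hc, hcs⟩ := hφ s
  obtain ⟨d, hd, hdt⟩ := hφ t
  rw [hc, hd]
  change classDist S s t ≤ classDist S c d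
  have h1 := classDist_triangle hK s c t
  have h2 := classDist_triangle hK c d t
  rw [classDist_comm s c] at h1
  omega

/-- Weak duality. -/
lemma weakValue_le_frameCost [Finite T] (hK : IsKClutter (anticliques S))
    (hV : (V : Set α) = V(G)) {φ : α → FrameVertex S} (hφ : IsFrameMap S φ)
    {f : TPath G T →₀ ℝ} (hf : IsFractionalFlow G T f) :
    8 * weakValue S f ≤ frameCost G V φ := by
  let g (x y : α) : ℝ := frameDist (φ x) (φ y)
  -- The 8 is a factor 4 between reward and class distance and a factor 2 from ordered pairs.
  have hP : ∀ P : TPath G T, 8 * weakReward S P.source P.target ≤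
      ∑ x ∈ V, ∑ y ∈ V, (P.traversals x y : ℝ) * g x y := by
    intro P
    rw [P.sum_traversals_mul]
    refine le_trans ?_ (P.isWalk.frameDist_le hK hV φ)
    have h1 := classDist_cast (S := S) P.unclosed
    have h2 : (classDist S P.source P.target : ℝ) ≤ frameDist (φ P.source) (φ P.target) := by
      exact_mod_cast hφ.classDist_le hK P.source P.target
    linarith
  calc 8 * weakValue S f
      = f.sum fun P w => w * (8 * weakReward S P.source P.target) := by
        rw [weakValue, Finsupp.mul_sum]
        exact Finsupp.sum_congr fun P _ => by ring
    _ ≤ f.sum fun P w => w * ∑ x ∈ V, ∑ y ∈ V, (P.traversals x y : ℝ) * g x y :=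
        Finset.sum_le_sum fun P _ => mul_le_mul_of_nonneg_left (hP P) (hf.nonneg P)
    _ = ∑ x ∈ V, ∑ y ∈ V, (f.sum fun P w => w * (P.traversals x y : ℝ)) * g x y := by
        simp only [Finsupp.sum, Finset.mul_sum, Finset.sum_mul]
        rw [Finset.sum_comm]
        refine Finset.sum_congr rfl fun x _ => ?_
        rw [Finset.sum_comm]
        exact Finset.sum_congr rfl fun y _ => Finset.sum_congr rfl fun P _ => by ring
    _ ≤ ∑ x ∈ V, ∑ y ∈ V, (edgeCount G x y : ℝ) * g x y := by
        refine Finset.sum_le_sum fun x hx => Finset.sum_le_sum fun y hy => ?_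
        refine mul_le_mul_of_nonneg_right (hf.capacity x ?_ y ?_) (Nat.cast_nonneg _)
        · rwa [← hV]
        · rwa [← hV]
    _ = frameCost G V φ := by
        simp only [frameCost, g]
        push_cast
        rfl

lemma TPath.traversals_le_edgeCount (hE : (E : Set β) = E(G)) (P : TPath G T) (x y : α) :
    P.traversals x y ≤ edgeCount G x y :=
  Set.ncard_le_ncard (fun _ h => h.2)
    ((hE ▸ E.finite_toSet : E(G).Finite).subset fun _ h => Graph.IsLink.edge_mem h)

/-- A length function on the pairs of nodes that certifies an upper bound for the values of the
fractional flows. -/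
lemma exists_dual_length (hV : (V : Set α) = V(G)) (hE : (E : Set β) = E(G)) {θ : ℝ}
    (hθ : ∀ f : TPath G T →₀ ℝ, IsFractionalFlow G T f → weakValue S f ≤ θ) :
    ∃ l : α → α → ℝ, (∀ x y, 0 ≤ l x y) ∧
      (∀ P : TPath G T, weakReward S P.source P.target ≤
        ∑ x ∈ V, ∑ y ∈ V, (P.traversals x y : ℝ) * l x y) ∧
      ∑ x ∈ V, ∑ y ∈ V, (edgeCount G x y : ℝ) * l x y ≤ θ := by
  classical
  -- Duality is applied to positive capacities only. Pairs without edges are traversed by no path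
  -- and get length 0.
  let I := (V ×ˢ V).filter fun z => 0 < edgeCount G z.1 z.2
  obtain ⟨l, hl0, hlP, hlc⟩ := exists_dual_of_packing_le (I := I)
    (fun (P : TPath G T) z => (P.traversals z.1.1 z.1.2 : ℝ))
    (fun P => weakReward S P.source P.target) (fun z => (edgeCount G z.1.1 z.1.2 : ℝ))
    (fun z => by exact_mod_cast (Finset.mem_filter.1 z.2).2) θ (fun f hf0 hfc => by
      have hf : IsFractionalFlow G T f := by
        refine ⟨hf0, fun x hx y hy => ?_⟩
        rw [← hV] at hx hy
        rcases Nat.eq_zero_or_pos (edgeCount G x y) with h0 | hpos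
        · rw [h0, Nat.cast_zero]
          refine (Finset.sum_eq_zero fun P _ => ?_).le
          have := P.traversals_le_edgeCount hE x y
          simp [show P.traversals x y = 0 by omega]
        · exact hfc ⟨(x, y), Finset.mem_filter.2 ⟨Finset.mk_mem_product hx hy, hpos⟩⟩
      refine le_trans (le_of_eq ?_) (hθ f hf)
      exact Finsupp.sum_congr fun P _ => mul_comm _ _)
  let l' (x y : α) : ℝ := if h : (x, y) ∈ I then l ⟨(x, y), h⟩ else 0
  have hsum : ∀ a : α → α → ℝ,
      ∑ x ∈ V, ∑ y ∈ V, a x y * l' x y = ∑ i : I, a i.1.1 i.1.2 * l i := by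
    intro a
    rw [← Finset.sum_product' (f := fun x y => a x y * l' x y),
      ← Finset.sum_subset (Finset.filter_subset (fun z => 0 < edgeCount G z.1 z.2) (V ×ˢ V)),
      ← Finset.sum_coe_sort]
    · refine Finset.sum_congr rfl fun i _ => ?_
      have : ((i.1.1, i.1.2) : α × α) ∈ I := i.2
      simp [l', this]
    · intro z _ hz
      have : ((z.1, z.2) : α × α) ∉ I := hz
      simp [l', this]
  refine ⟨l', fun x y => ?_, fun P => ?_, ?_⟩
  · dsimp only [l']
    split_ifs <;> simp [hl0]
  · rw [hsum]
    exact hlP P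
  · rw [hsum]
    exact hlc

open MeasureTheory in
/-- A dual length is dominated by the frame distance under a suitable map of the nodes. -/
lemma exists_isFrameMap_frameCost_le [Finite T] (hK : IsKClutter (anticliques S))
    (hV : (V : Set α) = V(G)) (hE : (E : Set β) = E(G)) (hT : T ⊆ V(G)) {θ : ℝ}
    (hθ : ∀ f : TPath G T →₀ ℝ, IsFractionalFlow G T f → weakValue S f ≤ θ) :
    ∃ φ : α → FrameVertex S, IsFrameMap S φ ∧ frameCost G V φ ≤ 8 * θ := by
  classical
  -- Without terminals there are no positions; the constant map costs 0, and the zero flow gives `0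
  -- ≤ θ`.
  rcases isEmpty_or_nonempty T with hT0 | hT0
  · refine ⟨fun _ => .center, fun t => hT0.elim t, ?_⟩
    have h0 := hθ 0 ⟨by simp, by simp⟩
    simp only [weakValue, Finsupp.sum_zero_index] at h0
    simp [frameCost, frameDist_self, h0]
  obtain ⟨l, hl0, hlP, hlc⟩ := exists_dual_length (S := S) hV hE hθ
  -- The factor 4 turns rewards into class distances.
  let L (e : β) : ℝ := 4 * edgeSum G V l e
  have hL : ∀ e, 0 ≤ L e := fun e => mul_nonneg (by norm_num) (edgeSum_nonneg hl0 e)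
  have hP : ∀ P : TPath G T, (classDist S P.source P.target : ℝ) ≤ (P.edges.map L).sum := by
    intro P
    have h := hlP P
    rw [P.sum_traversals_mul] at h
    rw [classDist_cast P.unclosed, List.sum_map_mul_left]
    linarith
  choose c A p q hpos using fun v : α => exists_isPosition (S := S)
    (a := fun t : T => affinity G L v t) (affinity_add_affinity_le hL hP v)
  let φ (r : ℝ) (v : α) : FrameVertex S :=
    roundVertex (c v) (A v) ((p v + q v) / 2) ((p v - q v) / 2) r
  have hedge : ∀ e : β, ∃ g : ℝ → ℝ, e ∈ E → IntegrableOn g (Set.Ioc 0 1) ∧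
      ∫ r in Set.Ioc (0 : ℝ) 1, g r ≤ L e ∧ ∀ r ∈ Set.Ioc (0 : ℝ) 1,
        ((edgeSum G V (fun x y => frameDist (φ r x) (φ r y)) e : ℕ) : ℝ) ≤ 2 * g r := by
    intro e
    by_cases he : e ∈ E
    · rw [← Finset.mem_coe, hE] at he
      obtain ⟨x, y, hxy⟩ := G.exists_isLink_of_mem_edgeSet he
      obtain ⟨g, hg1, hg2, hg3⟩ :=
        (isNear_affinity hL hP hxy).exists_integrable_bound hK (hpos x) (hpos y)
      refine ⟨g, fun _ => ⟨hg1, hg2, fun r hr => ?_⟩⟩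
      rw [edgeSum_frameDist hV (φ r) hxy]
      push_cast
      exact mul_le_mul_of_nonneg_left (hg3 r hr) (by norm_num)
    · exact ⟨0, fun h => absurd h he⟩
  choose g hg using hedge
  -- The expectation bounds are summed before a threshold is chosen, so that one threshold serves
  -- all edges together.
  obtain ⟨r, hr, hle⟩ := exists_threshold_le (h := fun r => ∑ e ∈ E, g e r) (c := ∑ e ∈ E, L e)
    (integrable_finsetSum _ fun e he => (hg e he).1) (by
      rw [integral_finsetSum _ fun e he => (hg e he).1]
      exact Finset.sum_le_sum fun e he => (hg e he).2.1)
  refine ⟨φ r, fun t => ⟨c t, (hpos t).exists_round_eq (affinity_self hL (hT t.2)) hr.2⟩, ?_⟩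
  rw [frameCost_eq_sum hE]
  push_cast
  calc ∑ e ∈ E, ((edgeSum G V (fun x y => frameDist (φ r x) (φ r y)) e : ℕ) : ℝ)
      ≤ ∑ e ∈ E, 2 * g e r := Finset.sum_le_sum fun e he => (hg e he).2.2 r hr
    _ = 2 * ∑ e ∈ E, g e r := by rw [Finset.mul_sum]
    _ ≤ 2 * ∑ e ∈ E, L e := by linarith
    _ = 8 * ∑ x ∈ V, ∑ y ∈ V, (edgeCount G x y : ℝ) * l x y := by
        rw [sum_edgeCount_mul hE, ← Finset.mul_sum]
        ring
    _ ≤ 8 * θ := by linarith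

end Duality

/-! ### Existence of a maximum flow -/

section Maximum

variable {α β : Type*} {G : Graph α β} {T : Set α} {E : Finset β}

lemma finite_tPath [Finite T] (hE : (E : Set β) = E(G)) : Finite (TPath G T) := by
  classical
  have hmem : ∀ P : TPath G T, ∀ e ∈ P.edges, e ∈ E := fun P e he => by
    rw [← Finset.mem_coe, hE]
    exact P.isWalk.mem_edgeSet e he
  let F (P : TPath G T) : T × T × {l : List E // l.Nodup} :=
    (P.source, P.target, ⟨P.edges.attachWith _ (hmem P),
      List.Nodup.of_map Subtype.val (by simpa using P.nodup)⟩)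
  refine Finite.of_injective F fun P Q h => ?_
  simp only [F, Prod.mk.injEq, Subtype.mk.injEq] at h
  obtain ⟨h1, h2, h3⟩ := h
  have h4 := congrArg (List.map Subtype.val) h3
  simp only [List.attachWith_map_subtype_val] at h4
  cases P
  cases Q
  simp only at h1 h2 h4
  subst h1 h2 h4
  rfl

lemma TPath.exists_one_le_traversals (P : TPath G T) :
    ∃ x ∈ V(G), ∃ y ∈ V(G), 1 ≤ P.traversals x y := by
  obtain ⟨e, he⟩ := List.exists_mem_of_ne_nil _
    (P.isWalk.ne_nil (Subtype.coe_injective.ne P.unclosed))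
  obtain ⟨x, y, hxy⟩ := G.exists_isLink_of_mem_edgeSet (P.isWalk.mem_edgeSet e he)
  refine ⟨x, hxy.left_mem, y, hxy.right_mem, ?_⟩
  rw [Nat.one_le_iff_ne_zero, TPath.traversals]
  refine Set.ncard_ne_zero_of_mem (a := e) ⟨he, hxy⟩ ?_
  exact (List.finite_toSet P.edges).subset fun _ h => h.1

lemma edgeCount_le_card (hE : (E : Set β) = E(G)) (x y : α) : edgeCount G x y ≤ E.card := by
  rw [← Set.ncard_coe_finset, hE]
  exact Set.ncard_le_ncard (fun _ h => h.edge_mem) (hE ▸ E.finite_toSet)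

lemma isGreatest_theta [Finite T] (hE : (E : Set β) = E(G)) (S : SimpleGraph T) :
    IsGreatest (weakValues G T S) (theta G T S) := by
  classical
  have := finite_tPath (T := T) hE
  have := Fintype.ofFinite (TPath G T)
  let toF (g : TPath G T → ℝ) : TPath G T →₀ ℝ := Finsupp.equivFunOnFinite.symm g
  have hsum : ∀ g (a : TPath G T → ℝ), ((toF g).sum fun P w => w * a P) = ∑ P, g P * a P :=
    fun g a => Finsupp.sum_fintype _ _ (by simp)
  let C : Set (TPath G T → ℝ) := {g | (∀ P, 0 ≤ g P) ∧ ∀ x ∈ V(G), ∀ y ∈ V(G),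
    ∑ P, g P * (P.traversals x y : ℝ) ≤ edgeCount G x y}
  have hCflow : ∀ g, g ∈ C ↔ IsFractionalFlow G T (toF g) := by
    intro g
    constructor
    · rintro ⟨h1, h2⟩
      exact ⟨h1, fun x hx y hy => by rw [hsum]; exact h2 x hx y hy⟩
    · rintro ⟨h1, h2⟩
      exact ⟨h1, fun x hx y hy => by rw [← hsum]; exact h2 x hx y hy⟩
  have hclosed : IsClosed C := by
    simp only [C, Set.ofPred_and, Set.ofPred_forall]
    refine (isClosed_iInter fun P => isClosed_le (by fun_prop) (by fun_prop)).inter ?_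
    exact isClosed_iInter fun x => isClosed_iInter fun _ => isClosed_iInter fun y =>
      isClosed_iInter fun _ => isClosed_le (by fun_prop) (by fun_prop)
  -- Every path traverses an edge, so its weight is at most some capacity.
  have hcompact : IsCompact C := by
    refine (isCompact_univ_pi fun _ : TPath G T =>
      isCompact_Icc (a := (0 : ℝ)) (b := E.card)).of_isClosed_subset hclosed ?_
    rintro g ⟨h1, h2⟩ P -
    refine ⟨h1 P, ?_⟩
    obtain ⟨x, hx, y, hy, hxy⟩ := P.exists_one_le_traversals
    calc g P ≤ g P * (P.traversals x y : ℝ) :=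
          le_mul_of_one_le_right (h1 P) (by exact_mod_cast hxy)
      _ ≤ ∑ P, g P * (P.traversals x y : ℝ) :=
          Finset.single_le_sum (f := fun P => g P * (P.traversals x y : ℝ))
            (fun Q _ => mul_nonneg (h1 Q) (Nat.cast_nonneg _)) (Finset.mem_univ P)
      _ ≤ edgeCount G x y := h2 x hx y hy
      _ ≤ E.card := by exact_mod_cast edgeCount_le_card hE x y
  have himage : weakValues G T S =
      (fun g : TPath G T → ℝ => ∑ P, g P * weakReward S P.source P.target) '' C := by
    ext r
    constructor
    · rintro ⟨f, hf, rfl⟩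
      have hf' : toF f = f := Finsupp.equivFunOnFinite.symm_apply_apply f
      refine ⟨f, (hCflow f).2 (hf'.symm ▸ hf), ?_⟩
      simp only
      rw [← hsum, hf', weakValue]
      exact Finsupp.sum_congr fun P _ => mul_comm _ _
    · rintro ⟨g, hg, rfl⟩
      refine ⟨toF g, (hCflow g).1 hg, ?_⟩
      simp only
      rw [← hsum, weakValue]
      exact Finsupp.sum_congr fun P _ => mul_comm _ _
  rw [theta, himage]
  refine (hcompact.image (by fun_prop)).isGreatest_sSup (Set.Nonempty.image _ ⟨0, ?_⟩)
  exact ⟨by simp, by simp⟩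

end Maximum

/-! ### The frame cost under a split -/

section Split

variable {α β γ : Type*} {G : Graph α β} {G' : Graph α γ} {V : Finset α} {E : Finset β}
  {E' : Finset γ}

lemma frameCost_split_le [DecidableEq α] {ι : Type*} [Finite ι] {S : SimpleGraph ι}
    (hK : IsKClutter (anticliques S)) (hV : (V : Set α) = V(G)) (hE : (E : Set β) = E(G))
    (hE' : (E' : Set γ) = E(G')) {x : α} (hx : x ∈ V) (h : IsSplit G x G')
    (φ : α → FrameVertex S) : frameCost G' (V.erase x) φ ≤ frameCost G V φ := by
  classical
  obtain ⟨hVG', -, F, -, -, hcount₀, hdeg⟩ := h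
  have hcount : ∀ y z, y ≠ x → z ≠ x →
      edgeCount G' y z = edgeCount G y z + F.count s(y, z) := by
    intro y z hy hz
    convert hcount₀ y z hy hz
  have hV' : ((V.erase x : Finset α) : Set α) = V(G') := by
    rw [Finset.coe_erase, hV, hVG']
  let D (y z : α) : ℕ := frameDist (φ y) (φ z)
  have hcost : frameCost G V φ = ∑ y ∈ V.erase x, ∑ z ∈ V.erase x, edgeCount G y z * D y z +
      2 * ∑ y ∈ V.erase x, edgeCount G y x * D y x := by
    have hcomm : ∑ z ∈ V.erase x, edgeCount G x z * D x z =
        ∑ y ∈ V.erase x, edgeCount G y x * D y x :=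
      Finset.sum_congr rfl fun y _ => by rw [edgeCount_comm, show D x y = D y x from
        frameDist_comm _ _]
    have hself : frameDist (φ x) (φ x) = 0 := frameDist_self _
    simp only [frameCost]
    rw [← Finset.sum_erase_add V _ hx, ← Finset.sum_erase_add V (fun z => _ * frameDist (φ x) _) hx,
      hself, hcomm]
    simp_rw [← Finset.sum_erase_add V (fun z => _ * frameDist _ (φ z)) hx]
    rw [Finset.sum_add_distrib]
    simp only [D]
    ring
  -- As `y` keeps its degree, new edge ends at `y` replace its edges to `x`. Equality may fail
  -- because a new loop has two ends at `y` but is counted once here.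
  have hcount' : ∀ y ∈ V.erase x, ∑ z ∈ V.erase x, F.count s(y, z) ≤ edgeCount G y x := by
    intro y hy
    have h1 := hdeg y (by rw [← hV']; exact hy)
    have hne := (Finset.mem_erase.1 hy).1
    rw [degree_eq_sum hV' hE', degree_eq_sum hV hE, ← Finset.sum_erase_add V _ hx,
      hcount y y hne hne,
      Finset.sum_congr rfl fun z hz => hcount y z hne (Finset.mem_erase.1 hz).1,
      Finset.sum_add_distrib] at h1
    omega
  have hnew : ∑ y ∈ V.erase x, ∑ z ∈ V.erase x, F.count s(y, z) * D y z ≤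
      2 * ∑ y ∈ V.erase x, edgeCount G y x * D y x := by
    have hswap : ∑ y ∈ V.erase x, ∑ z ∈ V.erase x, F.count s(y, z) * D x z =
        ∑ y ∈ V.erase x, ∑ z ∈ V.erase x, F.count s(y, z) * D y x := by
      rw [Finset.sum_comm]
      refine Finset.sum_congr rfl fun y _ => Finset.sum_congr rfl fun z _ => ?_
      rw [Sym2.eq_swap, show D x y = D y x from frameDist_comm _ _]
    -- A new edge is no longer than the detour through `x` that it replaces.
    calc ∑ y ∈ V.erase x, ∑ z ∈ V.erase x, F.count s(y, z) * D y z
        ≤ ∑ y ∈ V.erase x, ∑ z ∈ V.erase x, F.count s(y, z) * (D y x + D x z) :=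
          Finset.sum_le_sum fun y _ => Finset.sum_le_sum fun z _ =>
            Nat.mul_le_mul_left _ (frameDist_triangle hK _ _ _)
      _ = 2 * ∑ y ∈ V.erase x, (∑ z ∈ V.erase x, F.count s(y, z)) * D y x := by
          simp only [mul_add, Finset.sum_add_distrib, hswap, Finset.sum_mul]
          ring
      _ ≤ 2 * ∑ y ∈ V.erase x, edgeCount G y x * D y x :=
          Nat.mul_le_mul_left _ (Finset.sum_le_sum fun y hy =>
            Nat.mul_le_mul_right _ (hcount' y hy))
  have hcost' : frameCost G' (V.erase x) φ =
      ∑ y ∈ V.erase x, ∑ z ∈ V.erase x, edgeCount G y z * D y z +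
        ∑ y ∈ V.erase x, ∑ z ∈ V.erase x, F.count s(y, z) * D y z := by
    rw [← Finset.sum_add_distrib]
    refine Finset.sum_congr rfl fun y hy => ?_
    rw [← Finset.sum_add_distrib]
    refine Finset.sum_congr rfl fun z hz => ?_
    rw [hcount y z (Finset.mem_erase.1 hy).1 (Finset.mem_erase.1 hz).1, add_mul]
  rw [hcost, hcost']
  exact Nat.add_le_add_left hnew _

end Split

/-! ### Half-integrality and splits of K-networks -/

section Network

variable {α β γ : Type*} {G : Graph α β} {T : Set α} {S : SimpleGraph T}

lemma IsKNetwork.finite_terminals (hN : IsKNetwork G T S) : Finite T :=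
  (hN.finite_vertexSet.subset hN.terminals_subset).to_subtype

lemma IsKNetwork.isGreatest_theta (hN : IsKNetwork G T S) :
    IsGreatest (weakValues G T S) (theta G T S) :=
  have := hN.finite_terminals
  PathPacking.isGreatest_theta (E := hN.finite_edgeSet.toFinset) (by simp) S

/-- The weak problem has the same optimum as the minimization of the frame cost. -/
lemma IsKNetwork.exists_frameCost_eq (hN : IsKNetwork G T S) {V : Finset α}
    (hV : (V : Set α) = V(G)) :
    ∃ φ : α → FrameVertex S, IsFrameMap S φ ∧ 8 * theta G T S = frameCost G V φ := by
  have := hN.finite_terminals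
  obtain ⟨⟨f, hf, hfθ⟩, hmax⟩ := hN.isGreatest_theta
  obtain ⟨φ, hφ, hle⟩ := exists_isFrameMap_frameCost_le (E := hN.finite_edgeSet.toFinset)
    hN.isKClutter hV (by simp) hN.terminals_subset fun f hf => hmax ⟨f, hf, rfl⟩
  refine ⟨φ, hφ, le_antisymm ?_ hle⟩
  rw [← hfθ]
  exact weakValue_le_frameCost hN.isKClutter hV hφ hf

lemma IsKNetwork.four_dvd_frameCost (hN : IsKNetwork G T S) {V : Finset α}
    (hV : (V : Set α) = V(G)) {φ : α → FrameVertex S} (hφ : IsFrameMap S φ) :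
    4 ∣ frameCost G V φ := by
  -- Terminals are mapped to terminals of the frame, so a node on a line is inner.
  refine PathPacking.four_dvd_frameCost (E := hN.finite_edgeSet.toFinset) hV (by simp) φ
    fun x hx hl => hN.even_degree x ⟨hV ▸ hx, fun hxT => ?_⟩
  obtain ⟨c, hc, -⟩ := hφ ⟨x, hxT⟩
  simp only at hc
  rw [hc] at hl
  exact hl

lemma IsKNetwork.exists_two_mul_theta_eq (hN : IsKNetwork G T S) :
    ∃ m : ℕ, 2 * theta G T S = m := by
  have hV : ((hN.finite_vertexSet.toFinset : Finset α) : Set α) = V(G) := by simp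
  obtain ⟨φ, hφ, h⟩ := hN.exists_frameCost_eq hV
  obtain ⟨m, hm⟩ := hN.four_dvd_frameCost hV hφ
  refine ⟨m, ?_⟩
  rw [hm] at h
  push_cast at h
  linarith

lemma IsKNetwork.split (hN : IsKNetwork G T S) {x : α} (hx : x ∈ V(G) \ T) {G' : Graph α γ}
    (h : IsSplit G x G') : IsKNetwork G' T S where
  finite_vertexSet := by
    rw [h.1]
    exact hN.finite_vertexSet.sdiff
  finite_edgeSet := h.2.1
  terminals_subset t ht := by
    rw [h.1]
    exact ⟨hN.terminals_subset ht, fun htx => hx.2 (htx ▸ ht)⟩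
  even_degree y hy := by
    obtain ⟨hVG', -, F, -, -, -, hdeg⟩ := h
    rw [hdeg y hy.1]
    rw [hVG'] at hy
    exact hN.even_degree y ⟨hy.1.1, hy.2⟩
  isKClutter := hN.isKClutter

/-- An optimal frame map for `G` is a frame map for `G'` too, of no larger cost, and weak duality
applies to it. -/
lemma IsKNetwork.theta_split_le (hN : IsKNetwork G T S) {x : α} (hx : x ∈ V(G) \ T)
    {G' : Graph α γ} (h : IsSplit G x G') : theta G' T S ≤ theta G T S := by
  classical
  have := hN.finite_terminals
  have hN' := hN.split hx h
  have hV : ((hN.finite_vertexSet.toFinset : Finset α) : Set α) = V(G) := by simp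
  have hV' : ((hN.finite_vertexSet.toFinset.erase x : Finset α) : Set α) = V(G') := by
    rw [Finset.coe_erase, hV, h.1]
  obtain ⟨φ, hφ, heq⟩ := hN.exists_frameCost_eq hV
  obtain ⟨f, hf, hfθ⟩ := hN'.isGreatest_theta.1
  have h1 := weakValue_le_frameCost hN.isKClutter hV' hφ hf
  have h2 : (frameCost G' (hN.finite_vertexSet.toFinset.erase x) φ : ℝ) ≤
      frameCost G hN.finite_vertexSet.toFinset φ := by
    exact_mod_cast frameCost_split_le (E := hN.finite_edgeSet.toFinset)
      (E' := hN'.finite_edgeSet.toFinset) hN.isKClutter hV (by simp) (by simp)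
      (by simpa using hx.1) h φ
  rw [hfθ] at h1
  linarith

end Network

end

end PathPacking

theorem mainTheorem4 {α β γ : Type*} (G : Graph α β) (T : Set α) (S : SimpleGraph T)
    (hN : PathPacking.IsKNetwork G T S) :
    IsGreatest (PathPacking.weakValues G T S) (PathPacking.theta G T S) ∧
    (∃ m : ℕ, 2 * PathPacking.theta G T S = m) ∧
    ∀ x ∈ V(G) \ T, ∀ G' : Graph α γ, PathPacking.IsSplit G x G' →
      PathPacking.IsKNetwork G' T S ∧
      IsGreatest (PathPacking.weakValues G' T S) (PathPacking.theta G' T S) ∧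
      ∃ k : ℕ, PathPacking.theta G' T S = PathPacking.theta G T S - (k : ℝ) / 2 := by
  refine ⟨hN.isGreatest_theta, hN.exists_two_mul_theta_eq, fun x hx G' h => ?_⟩
  have hN' := hN.split hx h
  refine ⟨hN', hN'.isGreatest_theta, ?_⟩
  obtain ⟨m, hm⟩ := hN.exists_two_mul_theta_eq
  obtain ⟨n, hn⟩ := hN'.exists_two_mul_theta_eq
  have hle := hN.theta_split_le hx h
  have hnm : n ≤ m := by
    have : (n : ℝ) ≤ m := by linarith
    exact_mod_cast this
  refine ⟨m - n, ?_⟩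
  rw [Nat.cast_sub hnm]
  linarith
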